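/- Let $\alpha_1,\alpha_2\in(0,1]$, let $A=(a_{ij})\in\mathbb R^{2\times 2}$, and let $\beta\in\{\alpha_1,\alpha_2,\alpha_1+\alpha_2\}$. Put $$Q(s)=s^{\alpha_1+\alpha_2}-a_{11}s^{\alpha_2}-a_{22}s^{\alpha_1}+\det A\qquad(s\in\mathbb C),$$ with principal branches of the powers (and $0^{\gamma}=0$ for $\gamma>0$), and assume that all zeros of $Q$ lie in the open left half-plane $\{\operatorname{Re}s<0\}$. Let $\mathcal S^\beta$ be the inverse Laplace transform of $s\mapsto s^{\alpha_1+\alpha_2-\beta}/Q(s)$, i.e. the continuous function $\mathcal S^\beta:(0,\infty)\to\mathbb R$ for which $\int_0^\infty e^{-st}\mathcal S^\beta(t)\,dt$ converges absolutely and equals $s^{\alpha_1+\alpha_2-\beta}/Q(s)$ for all $s$ in some right half-plane. Then $\mathcal S^\beta$ exists, and for every continuous $g:[0,\infty)\to\mathbb R$ the integrals $$F_g^\beta(t)=\int_0^t\mathcal S^\beta(t-s)g(s)\,ds,\qquad \bar F_g^\beta(t)=\int_0^t|\mathcal S^\beta(t-s)|\,|g(s)|\,ds\qquad(t\ge 0)$$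 converge absolutely, and the following hold. (i) If $g$ is bounded on $[0,\infty)$, then $\bar F_g^\beta$ and $F_g^\beta$ are bounded on $[0,\infty)$. (ii) If $\lim_{t\to\infty}g(t)=0$, then $\lim_{t\to\infty}\bar F_g^\beta(t)=\lim_{t\to\infty}F_g^\beta(t)=0$. (iii) If $g(t)=O(t^{-\eta})$ as $t\to\infty$ for some $\eta\ge 0$, then $\bar F_g^\beta(t)=O(t^{-\mu})$ and $F_g^\beta(t)=O(t^{-\mu})$ as $t\to\infty$, where $\mu=\min\{\alpha_1,\alpha_2,\eta\}$. -/

import Mathlib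

open Set Filter Topology MeasureTheory Asymptotics

namespace FracPlanar

noncomputable section

/-- `f` is the (one-sided) inverse Laplace transform of `F`: the function `f` on `(0, ∞)`
(extended by `0`) is continuous there, and for all `s` in some right half-plane the Laplace
integral `∫₀^∞ e^{-st} f(t) dt` converges absolutely and equals `F s`.
By Lerch's theorem there is at most one such `f`. -/
structure IsInverseLaplace (F : ℂ → ℂ) (f : ℝ → ℝ) : Prop where
  eq_zero : ∀ t : ℝ, t ≤ 0 → f t = 0
  continuousOn : ContinuousOn f (Ioi 0)
  laplace : ∃ σ : ℝ, ∀ s : ℂ, σ < s.re →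
    IntegrableOn (fun t : ℝ => Complex.exp (-s * (t : ℂ)) * (f t : ℂ)) (Ioi 0) ∧
      ∫ t in Ioi (0 : ℝ), Complex.exp (-s * (t : ℂ)) * (f t : ℂ) = F s

open Classical in
/-- The inverse Laplace transform `ℒ⁻¹{F}` (the zero function if there is none). -/
def inverseLaplace (F : ℂ → ℂ) : ℝ → ℝ :=
  if h : ∃ f : ℝ → ℝ, IsInverseLaplace F f then h.choose else 0

/-- The characteristic function
`Q(s) = s^(α₁+α₂) - a₁₁ s^α₂ - a₂₂ s^α₁ + det A`, with principal powers. -/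
def Q (α₁ α₂ : ℝ) (A : Matrix (Fin 2) (Fin 2) ℝ) (s : ℂ) : ℂ :=
  s ^ ((α₁ + α₂ : ℝ) : ℂ) - (A 0 0 : ℂ) * s ^ (α₂ : ℂ) - (A 1 1 : ℂ) * s ^ (α₁ : ℂ)
    + ((A.det : ℝ) : ℂ)

/-- The function `s ^ (α₁ + α₂ - β) / Q(s)`. -/
def symbolS (α₁ α₂ : ℝ) (A : Matrix (Fin 2) (Fin 2) ℝ) (β : ℝ) (s : ℂ) : ℂ :=
  s ^ ((α₁ + α₂ - β : ℝ) : ℂ) / Q α₁ α₂ A s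

/-- `S^β = ℒ⁻¹{ s ^ (α₁ + α₂ - β) / Q(s) }`. -/
def S (α₁ α₂ : ℝ) (A : Matrix (Fin 2) (Fin 2) ℝ) (β : ℝ) : ℝ → ℝ :=
  inverseLaplace (symbolS α₁ α₂ A β)

/-- The Laplace convolution `(f * g)(t) = ∫₀ᵗ f(t - s) g(s) ds`. -/
def conv (f g : ℝ → ℝ) (t : ℝ) : ℝ :=
  ∫ s in (0 : ℝ)..t, f (t - s) * g s

/-- Boundedness on `[0, ∞)`. -/
def BoundedOnHalfLine (f : ℝ → ℝ) : Prop :=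
  ∃ M : ℝ, ∀ t : ℝ, 0 ≤ t → |f t| ≤ M

end

end FracPlanar

/-! Write `m = min α₁ α₂`, `γ = α₁ + α₂ - β` and `G(s) = s^γ / Q(s)`. All three claims follow from
two facts about `S^β`: it is integrable on `(0, ∞)`, and it is `O(t^(-1-m))` at infinity. Splitting
the convolution at `t / 2` (`conv_abs_le`) then pairs the recent values of `g` with the full mass of
`S^β`, and the older values with its tail, which is `O(t^(-m))`.

Since `G` decays only like `|s|^(-β)`, its inversion integral need not converge absolutely. Its
derivative does better: `G'` is `O(|s|^(m-1))` at the origin and `O(|s|^(-1-β))` at infinity, hence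
integrable on the imaginary axis itself; `Q` has no zeros on the closed right half-plane. As `-G'`
should be the transform of `t S^β(t)`, one sets `h(t) = -(1/2π) ∫ e^{ity} G'(iy) dy` and takes `h(t)
/ t` for `S^β`.

Three estimates of `h` are needed: it is bounded; it is `O(t^(β/2))` because `∫ G'(iy) dy = 0`, so
`h(t) / t` is integrable at `0`; and it is `O(t^(-m))` at infinity by an integration by parts that
uses bounds on `G''`. Cauchy's formula on the axis and Fubini show that the transform of `h(t) / t`
has derivative `G'`. It equals `G` because both vanish at `+∞`. -/

namespace FracPlanar

/-! ### Uniqueness of the inverse Laplace transform -/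

/-- Lerch's theorem: a function has at most one continuous inverse Laplace transform. -/
theorem IsInverseLaplace.unique {F : ℂ → ℂ} {f g : ℝ → ℝ} (hf : IsInverseLaplace F f)
    (hg : IsInverseLaplace F g) : f = g := by
  obtain ⟨σ₁, h₁⟩ := hf.laplace
  obtain ⟨σ₂, h₂⟩ := hg.laplace
  set σ : ℝ := max σ₁ σ₂ + 1 with hσ
  have hσ₁ : σ₁ < σ := by rw [hσ]; linarith [le_max_left σ₁ σ₂]
  have hσ₂ : σ₂ < σ := by rw [hσ]; linarith [le_max_right σ₁ σ₂]
  -- On the line `Re s = σ` the difference of the two Laplace integrals is the Fourier transform of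
  -- `u`. It vanishes, so Fourier inversion kills `u` at every point of continuity.
  set u : ℝ → ℂ := fun t => Complex.exp (-(σ : ℂ) * (t : ℂ)) * ((f t - g t : ℝ) : ℂ) with hu
  have hu0 : ∀ t, t ∉ Ioi (0 : ℝ) → u t = 0 := fun t ht => by
    have : t ≤ 0 := by simpa using ht
    simp [hu, hf.eq_zero t this, hg.eq_zero t this]
  have key : ∀ w : ℝ, ∫ v : ℝ, Complex.exp (↑(-2 * Real.pi * v * w) * Complex.I) • u v = 0 := by
    intro w
    set s : ℂ := σ + (2 * Real.pi * w : ℝ) * Complex.I with hs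
    have hre : s.re = σ := by simp [hs]
    obtain ⟨i₁, e₁⟩ := h₁ s (by rw [hre]; exact hσ₁)
    obtain ⟨i₂, e₂⟩ := h₂ s (by rw [hre]; exact hσ₂)
    have : ∀ v : ℝ, Complex.exp (↑(-2 * Real.pi * v * w) * Complex.I) • u v
        = Complex.exp (-s * (v : ℂ)) * (f v : ℂ) - Complex.exp (-s * (v : ℂ)) * (g v : ℂ) := by
      intro v
      simp only [hu, smul_eq_mul, hs]
      rw [← mul_assoc, ← Complex.exp_add, ← mul_sub]
      push_cast
      congr 2
      ring
    rw [← setIntegral_eq_integral_of_forall_compl_eq_zero (s := Ioi (0 : ℝ))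
      (fun t ht => by rw [hu0 t ht, smul_zero])]
    simp_rw [this]
    rw [integral_sub i₁ i₂, e₁, e₂, sub_self]
  have hFu : FourierTransform.fourier u = 0 := by
    funext w
    rw [Real.fourier_real_eq_integral_exp_smul]
    exact key w
  have hint : Integrable u := by
    refine IntegrableOn.integrable_of_forall_notMem_eq_zero (s := Ioi (0 : ℝ)) ?_ hu0
    have := (h₁ σ (by simpa using hσ₁)).1.sub (h₂ σ (by simpa using hσ₂)).1
    refine this.congr (Eventually.of_forall fun t => ?_)
    simp [hu, mul_sub]
  funext t
  rcases le_or_gt t 0 with ht | ht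
  · rw [hf.eq_zero t ht, hg.eq_zero t ht]
  have hc : ContinuousAt u t := by
    have e₁ := hf.continuousOn.continuousAt (Ioi_mem_nhds ht)
    have e₂ := hg.continuousOn.continuousAt (Ioi_mem_nhds ht)
    have e₃ : ContinuousAt (fun t => ((f t - g t : ℝ) : ℂ)) t :=
      Complex.continuous_ofReal.continuousAt.comp (e₁.sub e₂)
    exact ContinuousAt.mul (by fun_prop) e₃
  have h0 := hint.fourierInv_fourier_eq (by rw [hFu]; exact integrable_zero _ _ _) hc
  rw [hFu] at h0
  have : u t = 0 := by
    rw [← h0, Real.fourierInv_eq']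
    simp
  simp only [hu, mul_eq_zero, Complex.exp_ne_zero, false_or] at this
  have := Complex.ofReal_eq_zero.mp this
  linarith

/-- Uniqueness makes the choice in `inverseLaplace` harmless: whatever is proved for an explicitly
constructed transform holds for `S`. -/
theorem inverseLaplace_eq {F : ℂ → ℂ} {f : ℝ → ℝ} (hf : IsInverseLaplace F f) :
    inverseLaplace F = f := by
  have h : ∃ f : ℝ → ℝ, IsInverseLaplace F f := ⟨f, hf⟩
  rw [inverseLaplace, dif_pos h]
  exact h.choose_spec.unique hf

/-! ### Integrals of holomorphic functions over vertical lines -/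

theorem integrableOn_Ioi_min_rpow {p r : ℝ} (hp : -1 < p) (hr : r < -1) :
    IntegrableOn (fun x : ℝ => min (|x| ^ p) (|x| ^ r)) (Ioi 0) := by
  have hm : Measurable (fun x : ℝ => min (|x| ^ p) (|x| ^ r)) := by fun_prop
  rw [← Ioc_union_Ioi_eq_Ioi (zero_le_one : (0 : ℝ) ≤ 1)]
  refine IntegrableOn.union ?_ ?_
  · have h := (intervalIntegrable_iff_integrableOn_Ioc_of_le zero_le_one).mp
      (intervalIntegral.intervalIntegrable_rpow' (a := 0) (b := 1) hp)
    refine Integrable.mono' h hm.aestronglyMeasurable ?_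
    refine (ae_restrict_iff' measurableSet_Ioc).mpr (Eventually.of_forall fun x hx => ?_)
    have hx0 : 0 < x := hx.1
    rw [Real.norm_of_nonneg (le_min (by positivity) (by positivity))]
    exact (min_le_left _ _).trans (by rw [abs_of_pos hx0])
  · have h := integrableOn_Ioi_rpow_of_lt hr zero_lt_one
    refine Integrable.mono' h hm.aestronglyMeasurable ?_
    refine (ae_restrict_iff' measurableSet_Ioi).mpr (Eventually.of_forall fun x hx => ?_)
    have hx0 : 0 < x := zero_lt_one.trans hx
    rw [Real.norm_of_nonneg (le_min (by positivity) (by positivity))]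
    exact (min_le_right _ _).trans (by rw [abs_of_pos hx0])

/-- One exponent serves the origin and the other infinity; the minimum is the dominating function
for all integrals over vertical lines below. -/
theorem integrable_min_rpow {p r : ℝ} (hp : -1 < p) (hr : r < -1) :
    Integrable (fun x : ℝ => min (|x| ^ p) (|x| ^ r)) := by
  have h := integrableOn_Ioi_min_rpow hp hr
  have h' : IntegrableOn (fun x : ℝ => min (|x| ^ p) (|x| ^ r)) (Iic 0) := by
    have h0 : IntegrableOn (fun x : ℝ => min (|x| ^ p) (|x| ^ r)) (Ici (-0)) := by
      rwa [neg_zero, integrableOn_Ici_iff_integrableOn_Ioi]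
    simpa using IntegrableOn.comp_neg_Iic h0
  rw [← integrableOn_univ, ← Iic_union_Ioi (a := (0 : ℝ))]
  exact h'.union h

theorem integrable_of_norm_le_rpow {φ : ℝ → ℂ} (hφ : Continuous φ) {M ε R : ℝ} (hε : 0 < ε)
    (hb : ∀ x, R ≤ |x| → ‖φ x‖ ≤ M * |x| ^ (-1 - ε)) : Integrable φ := by
  have hI := integrable_min_rpow (p := 0) (r := -1 - ε) (by norm_num) (by linarith)
  refine hφ.locallyIntegrable.integrable_of_isBigO_cocompact ?_
    (hI.integrableAtFilter _)
  refine IsBigO.of_bound M ?_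
  have : ∀ᶠ x : ℝ in cocompact ℝ, max R 1 ≤ ‖x‖ :=
    tendsto_norm_cocompact_atTop.eventually_ge_atTop _
  filter_upwards [this] with x hx
  rw [Real.norm_eq_abs] at hx
  have h1 : 1 ≤ |x| := (le_max_right _ _).trans hx
  refine (hb x ((le_max_left _ _).trans hx)).trans (le_of_eq ?_)
  rw [Real.rpow_zero, min_eq_right (Real.rpow_le_one_of_one_le_of_nonpos h1 (by linarith)),
    Real.norm_of_nonneg (by positivity)]

/-- The integral of a decaying holomorphic function along the boundary of a half-plane is zero. -/
theorem integral_vertical_eq_zero {Φ : ℂ → ℂ} {c : ℝ} (hc : 0 ≤ c)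
    (hd : DifferentiableOn ℂ Φ {z | c ≤ z.re}) {M ε R₀ : ℝ} (hε : 0 < ε)
    (hb : ∀ z : ℂ, c ≤ z.re → R₀ ≤ ‖z‖ → ‖Φ z‖ ≤ M * ‖z‖ ^ (-1 - ε)) :
    Integrable (fun y : ℝ => Φ (c + y * Complex.I)) ∧ ∫ y : ℝ, Φ (c + y * Complex.I) = 0 := by
  have hM : 0 ≤ M := by
    set x : ℝ := max R₀ (c + 1)
    have hx : 0 < x := lt_of_lt_of_le (by linarith) (le_max_right _ _)
    have h := (norm_nonneg _).trans (hb x (by simpa using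
      (by linarith [le_max_right R₀ (c + 1)] : c ≤ x))
      (by rw [Complex.norm_of_nonneg hx.le]; exact le_max_left _ _))
    rw [Complex.norm_of_nonneg hx.le] at h
    by_contra hneg
    have : M * x ^ (-1 - ε) < 0 := mul_neg_of_neg_of_pos (not_le.mp hneg) (by positivity)
    linarith
  have hbig : ∀ z : ℂ, c ≤ z.re → ∀ R, 0 < R → R₀ ≤ R → R ≤ ‖z‖ → ‖Φ z‖ ≤ M * R ^ (-1 - ε) := by
    intro z hz R hR hR0 hRz
    refine (hb z hz (hR0.trans hRz)).trans (mul_le_mul_of_nonneg_left ?_ hM)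
    exact Real.rpow_le_rpow_of_nonpos hR hRz (by linarith)
  have hcont : Continuous (fun y : ℝ => Φ (c + y * Complex.I)) := by
    refine hd.continuousOn.comp_continuous (by fun_prop) (fun y => by simp)
  have him : ∀ y : ℝ, |y| ≤ ‖(c + y * Complex.I : ℂ)‖ := fun y => by
    simpa using Complex.abs_im_le_norm (c + y * Complex.I : ℂ)
  have hint : Integrable (fun y : ℝ => Φ (c + y * Complex.I)) := by
    refine integrable_of_norm_le_rpow hcont (M := M) (R := max R₀ 1) hε fun y hy => ?_
    have h1 : 1 ≤ |y| := (le_max_right _ _).trans hy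
    exact hbig _ (by simp) _ (by linarith) ((le_max_left _ _).trans hy) (him y)
  refine ⟨hint, ?_⟩
  have hlim := intervalIntegral_tendsto_integral hint tendsto_neg_atTop_atBot tendsto_id
  refine tendsto_nhds_unique hlim ?_
  -- The other three sides of the rectangle `[c, c + R] × [-R, R]` have total length `4R`, and `Φ`
  -- is at most `M R^(-1-ε)` on them.
  have hz : Tendsto (fun R : ℝ => 4 * M * R ^ (-ε)) atTop (𝓝 0) := by
    simpa using (tendsto_rpow_neg_atTop hε).const_mul (4 * M)
  refine squeeze_zero_norm' ?_ hz
  filter_upwards [eventually_ge_atTop (max R₀ 1)] with R hR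
  have hR1 : 1 ≤ R := (le_max_right _ _).trans hR
  have hR0 : R₀ ≤ R := (le_max_left _ _).trans hR
  have hRp : 0 < R := by linarith
  have hrect := Complex.integral_boundary_rect_eq_zero_of_differentiableOn Φ
    (⟨c, -R⟩ : ℂ) (⟨c + R, R⟩ : ℂ) (hd.mono fun z hz => by
      have := hz.1
      simp only [mem_preimage, uIcc_of_le (by linarith : c ≤ c + R)] at this
      exact this.1)
  simp only at hrect
  set K := M * R ^ (-1 - ε) with hK
  have b1 : ‖∫ x : ℝ in c..(c + R), Φ (x + ((-R : ℝ) : ℂ) * Complex.I)‖ ≤ K * |c + R - c| := by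
    refine intervalIntegral.norm_integral_le_of_norm_le_const fun x hx => ?_
    rw [uIoc_of_le (by linarith)] at hx
    refine hbig _ (by simpa using hx.1.le) R hRp hR0 ?_
    have := Complex.abs_im_le_norm (x + ((-R : ℝ) : ℂ) * Complex.I)
    simpa [abs_of_pos hRp] using this
  have b2 : ‖∫ x : ℝ in c..(c + R), Φ (x + (R : ℂ) * Complex.I)‖ ≤ K * |c + R - c| := by
    refine intervalIntegral.norm_integral_le_of_norm_le_const fun x hx => ?_
    rw [uIoc_of_le (by linarith)] at hx
    refine hbig _ (by simpa using hx.1.le) R hRp hR0 ?_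
    have := Complex.abs_im_le_norm (x + (R : ℂ) * Complex.I)
    simpa [abs_of_pos hRp] using this
  have b3 : ‖∫ y : ℝ in (-R)..R, Φ (((c + R : ℝ) : ℂ) + y * Complex.I)‖ ≤ K * |R - -R| := by
    refine intervalIntegral.norm_integral_le_of_norm_le_const fun y _ => ?_
    refine hbig _ (by simpa using hRp.le) R hRp hR0 ?_
    have := Complex.abs_re_le_norm (((c + R : ℝ) : ℂ) + y * Complex.I)
    have h2 : |c + R| = c + R := abs_of_pos (by linarith)
    simp [h2] at this
    push_cast
    linarith
  have e : Complex.I • (∫ y : ℝ in (-R)..R, Φ (c + y * Complex.I))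
      = (∫ x : ℝ in c..(c + R), Φ (x + ((-R : ℝ) : ℂ) * Complex.I))
        - (∫ x : ℝ in c..(c + R), Φ (x + (R : ℂ) * Complex.I))
        + Complex.I • ∫ y : ℝ in (-R)..R, Φ (((c + R : ℝ) : ℂ) + y * Complex.I) :=
    (sub_eq_zero.mp hrect).symm
  have e' := congrArg norm e
  rw [norm_smul, Complex.norm_I, one_mul] at e'
  simp only [id]
  rw [e']
  refine (norm_add_le _ _).trans ?_
  rw [norm_smul, Complex.norm_I, one_mul]
  have hsub := norm_sub_le (∫ x : ℝ in c..(c + R), Φ (x + ((-R : ℝ) : ℂ) * Complex.I))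
    (∫ x : ℝ in c..(c + R), Φ (x + (R : ℂ) * Complex.I))
  have hKR : K * R = M * R ^ (-ε) := by
    rw [hK, mul_assoc, ← Real.rpow_add_one hRp.ne']
    congr 2; ring
  have a1 : |c + R - c| = R := by rw [add_sub_cancel_left, abs_of_pos hRp]
  have a2 : |R - -R| = 2 * R := by rw [sub_neg_eq_add, abs_of_pos (by linarith)]; ring
  rw [a1] at b1 b2
  rw [a2] at b3
  nlinarith

/-! ### Cauchy's formula on the right half-plane, up to the imaginary axis -/

section

/-- This is the Poisson kernel of a half-plane, up to normalisation; it carries the value `2π F(s)`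
in `cauchy_vertical`. -/
theorem integrable_and_integral_poisson {σ : ℝ} (hσ : 0 < σ) (τ : ℝ) :
    Integrable (fun y : ℝ => 2 * σ / (σ ^ 2 + (y - τ) ^ 2)) ∧
      ∫ y : ℝ, 2 * σ / (σ ^ 2 + (y - τ) ^ 2) = 2 * Real.pi := by
  have e : ∀ y : ℝ, 2 * σ / (σ ^ 2 + (y - τ) ^ 2) = 2 / σ * (1 + ((y - τ) / σ) ^ 2)⁻¹ := by
    intro y
    field_simp
  simp_rw [e]
  have hi : Integrable (fun y : ℝ => (1 + ((y - τ) / σ) ^ 2)⁻¹) :=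
    (integrable_inv_one_add_sq.comp_div hσ.ne').comp_sub_right τ
  refine ⟨hi.const_mul _, ?_⟩
  rw [integral_const_mul, integral_sub_right_eq_self (fun y : ℝ => (1 + (y / σ) ^ 2)⁻¹) τ,
    Measure.integral_comp_div (fun y : ℝ => (1 + y ^ 2)⁻¹), integral_univ_inv_one_add_sq,
    abs_of_pos hσ, smul_eq_mul]
  field_simp

/-- Cauchy's formula for the half-plane `Re z > c`. -/
theorem cauchy_vertical {F : ℂ → ℂ} (hF : DifferentiableOn ℂ F {z | 0 < z.re}) {C β : ℝ}
    (hβ : 0 < β) (hb : ∀ z : ℂ, 0 < z.re → ‖F z‖ ≤ C * ‖z‖ ^ (-1 - β)) {c : ℝ} (hc : 0 < c)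
    {s : ℂ} (hs : c < s.re) :
    ∫ y : ℝ, F (c + y * Complex.I) / (s - (c + y * Complex.I)) = 2 * Real.pi * F s := by
  set σ := s.re - c with hσ
  have hσ0 : 0 < σ := by linarith
  -- `s'` is the mirror image of `s` in the line `Re z = c`. The term `F(s) / (s - z)` is not
  -- absolutely integrable on the line; pairing the pole at `s` with `s'` turns it into a Poisson
  -- kernel. The two remaining terms in `hpt` are holomorphic to the right of the line and decay
  -- fast enough to integrate to zero.
  set s' : ℂ := ⟨c - σ, s.im⟩ with hs'
  have hopen : IsOpen {z : ℂ | 0 < z.re} := isOpen_lt continuous_const Complex.continuous_re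
  have hsub : {z : ℂ | c ≤ z.re} ⊆ {z : ℂ | 0 < z.re} := fun z hz => lt_of_lt_of_le hc hz
  have hsmem : {z : ℂ | 0 < z.re} ∈ 𝓝 s := hopen.mem_nhds (hc.trans hs)
  have hC : 0 ≤ C := by
    have h := (norm_nonneg _).trans (hb 1 (by simp))
    simpa using h
  have hz' : ∀ z : ℂ, c ≤ z.re → σ ≤ ‖z - s'‖ := fun z hz => by
    have := Complex.abs_re_le_norm (z - s')
    simp only [Complex.sub_re, hs'] at this
    linarith [le_abs_self (z.re - (c - σ))]
  have hne' : ∀ z : ℂ, c ≤ z.re → z - s' ≠ 0 := fun z hz h => by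
    have := hz' z hz
    rw [h, norm_zero] at this
    linarith
  have hlin : DifferentiableOn ℂ (fun z : ℂ => z - s') {z | c ≤ z.re} := by fun_prop
  obtain ⟨i₁, e₁⟩ := integral_vertical_eq_zero (Φ := fun z => F z / (z - s')) hc.le
    ((hF.mono hsub).div hlin hne') (M := C / σ) (R₀ := 0) hβ (fun z hz _ => by
      rw [norm_div, div_mul_eq_mul_div]
      exact div_le_div₀ (by positivity) (hb z (hsub hz)) hσ0 (hz' z hz))
  obtain ⟨i₂, e₂⟩ := integral_vertical_eq_zero
    (Φ := fun z => dslope F s z * ((s - s') / (z - s'))) (M := (C + ‖F s‖) * 4 * ‖s - s'‖)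
    -- Beyond this radius `z` is at distance at least `‖z‖ / 2` from both `s` and `s'`; the `+ 1`
    -- excludes `z = s`, and the `1` gives `‖F z‖ ≤ C`.
    (R₀ := max 1 (max (2 * ‖s‖ + 1) (2 * ‖s'‖))) (ε := 1) hc.le
    ((((Complex.differentiableOn_dslope hsmem).mpr hF).mono hsub).mul
      ((differentiableOn_const _).div hlin hne')) one_pos (fun z hz hzR => by
      have hz1 : 1 ≤ ‖z‖ := (le_max_left _ _).trans hzR
      have hz2 : 2 * ‖s‖ + 1 ≤ ‖z‖ :=
        (le_max_left _ _).trans ((le_max_right _ _).trans hzR)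
      have hz3 : 2 * ‖s'‖ ≤ ‖z‖ := (le_max_right _ _).trans ((le_max_right _ _).trans hzR)
      have hzs : z ≠ s := by
        rintro rfl
        linarith [norm_nonneg z]
      have n1 : ‖z‖ / 2 ≤ ‖z - s‖ := by linarith [norm_sub_norm_le z s]
      have n2 : ‖z‖ / 2 ≤ ‖z - s'‖ := by linarith [norm_sub_norm_le z s']
      have hFz : ‖F z‖ ≤ C := (hb z (hsub hz)).trans (mul_le_of_le_one_right hC
        (Real.rpow_le_one_of_one_le_of_nonpos hz1 (by linarith)))
      have n3 : ‖F z - F s‖ ≤ C + ‖F s‖ := (norm_sub_le _ _).trans (by linarith)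
      rw [dslope_of_ne _ hzs, slope_def_field, norm_mul, norm_div, norm_div]
      have hpow : ‖z‖ ^ (-1 - 1 : ℝ) = (‖z‖ ^ 2)⁻¹ := by
        rw [show (-1 - 1 : ℝ) = -(2 : ℕ) by norm_num, Real.rpow_neg (norm_nonneg _),
          Real.rpow_natCast]
      rw [hpow]
      calc ‖F z - F s‖ / ‖z - s‖ * (‖s - s'‖ / ‖z - s'‖)
          ≤ (C + ‖F s‖) / (‖z‖ / 2) * (‖s - s'‖ / (‖z‖ / 2)) := by gcongr
        _ = (C + ‖F s‖) * 4 * ‖s - s'‖ * (‖z‖ ^ 2)⁻¹ := by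
          field_simp
          ring)
  obtain ⟨i₃, e₃⟩ := integrable_and_integral_poisson hσ0 s.im
  have hpt : ∀ y : ℝ, F (c + y * Complex.I) / (s - (c + y * Complex.I))
      = F s * ((2 * σ / (σ ^ 2 + (y - s.im) ^ 2) : ℝ) : ℂ)
        - dslope F s (c + y * Complex.I) * ((s - s') / ((c + y * Complex.I) - s'))
        - F (c + y * Complex.I) / ((c + y * Complex.I) - s') := by
    intro y
    set z : ℂ := c + y * Complex.I with hz
    have hzre : z.re = c := by simp [hz]
    have hzim : z.im = y := by simp [hz]
    have hzs : z ≠ s := fun h => by rw [h] at hzre; linarith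
    have h1 : z - s ≠ 0 := sub_ne_zero.mpr hzs
    have h1' : s - z ≠ 0 := sub_ne_zero.mpr hzs.symm
    have h2 : z - s' ≠ 0 := hne' z hzre.ge
    have hk : ((2 * σ / (σ ^ 2 + (y - s.im) ^ 2) : ℝ) : ℂ) = (s - s') / ((s - z) * (z - s')) := by
      -- On the line, `z - s'` is the complex conjugate of `s - z`.
      have hprod : (s - z) * (z - s') = ((σ ^ 2 + (y - s.im) ^ 2 : ℝ) : ℂ) := by
        apply Complex.ext
        · simp [hs', hzre, hzim, hσ, -Complex.ofReal_add]
          ring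
        · simp [hs', hzre, hzim, hσ, -Complex.ofReal_add]
          ring
      have hd : s - s' = ((2 * σ : ℝ) : ℂ) := by
        apply Complex.ext
        · simp [hs', hσ, -Complex.ofReal_mul]
          ring
        · simp [hs', -Complex.ofReal_mul]
      rw [hprod, hd, Complex.ofReal_div]
    rw [hk, dslope_of_ne _ hzs, slope_def_field]
    rw [← neg_sub z s] at h1' ⊢
    field_simp
    ring
  simp_rw [hpt]
  have i₃' : Integrable (fun y : ℝ => F s * ((2 * σ / (σ ^ 2 + (y - s.im) ^ 2) : ℝ) : ℂ)) :=
    i₃.ofReal.const_mul _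
  have i₄ : Integrable (fun y : ℝ => F s * ((2 * σ / (σ ^ 2 + (y - s.im) ^ 2) : ℝ) : ℂ)
      - dslope F s (c + y * Complex.I) * ((s - s') / ((c + y * Complex.I) - s'))) := i₃'.sub i₂
  rw [integral_sub i₄ i₁, integral_sub i₃' i₂, e₁, e₂, integral_const_mul, integral_complex_ofReal, e₃]
  push_cast
  ring

/-- `F` is holomorphic on the closed right half-plane without the origin, with the bounds
`C |z| ^ (m - 1)` and `C |z| ^ (-1 - β)`. -/
structure HalfPlaneBound (F : ℂ → ℂ) (C m β : ℝ) : Prop where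
  diff : ∀ z : ℂ, 0 ≤ z.re → z ≠ 0 → DifferentiableAt ℂ F z
  m_pos : 0 < m
  m_le : m ≤ 1
  β_pos : 0 < β
  near : ∀ z : ℂ, 0 ≤ z.re → z ≠ 0 → ‖F z‖ ≤ C * ‖z‖ ^ (m - 1)
  far : ∀ z : ℂ, 0 ≤ z.re → z ≠ 0 → ‖F z‖ ≤ C * ‖z‖ ^ (-1 - β)

variable {F : ℂ → ℂ} {C m β : ℝ}

theorem HalfPlaneBound.C_nonneg (hF : HalfPlaneBound F C m β) : 0 ≤ C := by
  have h := (norm_nonneg _).trans (hF.near 1 (by simp) one_ne_zero)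
  simpa using h

/-- Both exponents are nonpositive and `|y| ≤ ‖z‖`, so the bound is uniform in `c`. -/
theorem HalfPlaneBound.norm_le_min_rpow (hF : HalfPlaneBound F C m β) {c y : ℝ} (hc : 0 ≤ c)
    (hy : y ≠ 0) :
    ‖F (c + y * Complex.I)‖ ≤ C * min (|y| ^ (m - 1)) (|y| ^ (-1 - β)) := by
  have hC := hF.C_nonneg
  have hm := hF.m_le
  have hβ := hF.β_pos
  set z : ℂ := c + y * Complex.I with hz
  have hzre : z.re = c := by simp [hz]
  have hzim : z.im = y := by simp [hz]
  have hz0 : z ≠ 0 := fun h => hy (by rw [← hzim, h, Complex.zero_im])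
  have hyz : |y| ≤ ‖z‖ := hzim ▸ Complex.abs_im_le_norm z
  have hy0 : 0 < |y| := abs_pos.mpr hy
  rw [mul_min_of_nonneg _ _ hC]
  refine le_min ((hF.near z (hzre ▸ hc) hz0).trans ?_) ((hF.far z (hzre ▸ hc) hz0).trans ?_)
  · exact mul_le_mul_of_nonneg_left (Real.rpow_le_rpow_of_nonpos hy0 hyz (by linarith)) hC
  · exact mul_le_mul_of_nonneg_left (Real.rpow_le_rpow_of_nonpos hy0 hyz (by linarith)) hC

theorem ae_ne_zero : ∀ᵐ y : ℝ, y ≠ 0 := by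
  simp [ae_iff, measure_singleton]

theorem HalfPlaneBound.aestronglyMeasurable_vertical
    (hF : HalfPlaneBound F C m β) {c : ℝ} (hc : 0 ≤ c) :
    AEStronglyMeasurable (fun y : ℝ => F (c + y * Complex.I)) := by
  have h : ContinuousOn (fun y : ℝ => F (c + y * Complex.I)) {0}ᶜ := by
    intro y hy
    have hy : y ≠ 0 := hy
    have hz : DifferentiableAt ℂ F (c + y * Complex.I) := hF.diff _ (by simpa using hc) (fun h => hy (by
      simpa using congrArg Complex.im h))
    exact (hz.continuousAt.comp (f := fun y : ℝ => (c + y * Complex.I : ℂ))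
      (by fun_prop)).continuousWithinAt
  have h2 := h.aestronglyMeasurable (μ := volume) (measurableSet_singleton (0 : ℝ)).compl
  rwa [restrict_compl_singleton] at h2

theorem HalfPlaneBound.integrable_vertical (hF : HalfPlaneBound F C m β) {c : ℝ} (hc : 0 ≤ c) :
    Integrable (fun y : ℝ => F (c + y * Complex.I)) := by
  refine Integrable.mono' ((integrable_min_rpow (p := m - 1) (r := -1 - β) (by linarith [hF.m_pos])
    (by linarith [hF.β_pos])).const_mul C) (hF.aestronglyMeasurable_vertical hc) ?_
  filter_upwards [ae_ne_zero] with y hy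
  exact hF.norm_le_min_rpow hc hy

/-- Dominated convergence with the bound uniform in `c` moves the line onto the axis, although `F`
may be singular at the origin. The factor `k` will be the Cauchy kernel or the constant `1`. -/
theorem HalfPlaneBound.tendsto_integral_vertical (hF : HalfPlaneBound F C m β) {k : ℂ → ℂ} {B r : ℝ}
    (hr : 0 < r) (hk : ContinuousOn k {z | z.re < r}) (hkB : ∀ z : ℂ, z.re < r → ‖k z‖ ≤ B) :
    Tendsto (fun c : ℝ => ∫ y : ℝ, F (c + y * Complex.I) * k (c + y * Complex.I)) (𝓝[>] 0)
      (𝓝 (∫ y : ℝ, F (y * Complex.I) * k (y * Complex.I))) := by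
  have hsmall : ∀ᶠ c : ℝ in 𝓝[>] 0, 0 < c ∧ c < r := by
    filter_upwards [Ioo_mem_nhdsGT hr] with c hc using hc
  have hopen : IsOpen {z : ℂ | z.re < r} := isOpen_lt Complex.continuous_re continuous_const
  refine tendsto_integral_filter_of_dominated_convergence
    (fun y => C * min (|y| ^ (m - 1)) (|y| ^ (-1 - β)) * B) ?_ ?_
    (((integrable_min_rpow (by linarith [hF.m_pos]) (by linarith [hF.β_pos])).const_mul C).mul_const B) ?_
  · filter_upwards [hsmall] with c hc
    refine (hF.aestronglyMeasurable_vertical hc.1.le).mul (Continuous.aestronglyMeasurable ?_)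
    exact hk.comp_continuous (by fun_prop) (fun y => by simpa using hc.2)
  · filter_upwards [hsmall] with c hc
    filter_upwards [ae_ne_zero] with y hy
    rw [norm_mul]
    exact mul_le_mul (hF.norm_le_min_rpow hc.1.le hy)
      (hkB _ (by simpa using hc.2)) (norm_nonneg _)
      (mul_nonneg hF.C_nonneg (by positivity))
  · filter_upwards [ae_ne_zero] with y hy
    have hz0 : (y * Complex.I : ℂ) ≠ 0 := by simpa using hy
    have hc1 : ContinuousAt (fun z => F z * k z) (y * Complex.I) :=
      (hF.diff _ (by simp) hz0).continuousAt.mul (hk.continuousAt (hopen.mem_nhds (by simpa using hr)))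
    have hc2 : Tendsto (fun c : ℝ => (c + y * Complex.I : ℂ)) (𝓝[>] 0) (𝓝 (y * Complex.I)) := by
      have : ContinuousAt (fun c : ℝ => (c + y * Complex.I : ℂ)) 0 := by fun_prop
      have h := this.tendsto
      simp only [Complex.ofReal_zero, zero_add] at h
      exact h.mono_left nhdsWithin_le_nhds
    exact hc1.tendsto.comp hc2

/-- Cauchy's formula for the right half-plane, the integrand being singular at the origin. -/
theorem HalfPlaneBound.cauchy_imaginary_axis (hF : HalfPlaneBound F C m β) {s : ℂ} (hs : 0 < s.re) :
    ∫ y : ℝ, F (y * Complex.I) * (1 / (s - y * Complex.I)) = 2 * Real.pi * F s := by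
  have hne : ∀ z : ℂ, 0 < z.re → z ≠ 0 := fun z hz h => by simp [h] at hz
  have hd : DifferentiableOn ℂ F {z | 0 < z.re} := fun z hz =>
    (hF.diff z (le_of_lt hz) (hne z hz)).differentiableWithinAt
  -- Staying left of `Re s / 2` keeps the Cauchy kernel bounded.
  have hlow : ∀ z : ℂ, z.re < s.re / 2 → s.re / 2 ≤ ‖s - z‖ := fun z hz => by
    have := (le_abs_self _).trans (Complex.abs_re_le_norm (s - z))
    rw [Complex.sub_re] at this
    linarith
  have h := hF.tendsto_integral_vertical (k := fun z => 1 / (s - z))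
    (B := 2 / s.re) (r := s.re / 2) (half_pos hs) (by
      refine ContinuousOn.div (by fun_prop) (by fun_prop) fun z hz h => ?_
      have := hlow z hz
      rw [h, norm_zero] at this
      linarith) (fun z hz => by
      rw [norm_div, norm_one, ← one_div_div s.re 2]
      exact one_div_le_one_div_of_le (half_pos hs) (hlow z hz))
  refine tendsto_nhds_unique h (Tendsto.congr' ?_ tendsto_const_nhds)
  filter_upwards [Ioo_mem_nhdsGT (half_pos hs)] with c hc
  rw [← cauchy_vertical hd hF.β_pos (fun z hz => hF.far z hz.le (hne z hz)) hc.1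
    (by linarith [hc.2] : c < s.re)]
  simp_rw [mul_one_div]

/-- This is the vanishing of the kernel at `t = 0`; it allows `e^{ity}` to be replaced by `e^{ity} -
1`. -/
theorem HalfPlaneBound.integral_imaginary_axis_eq_zero
    (hF : HalfPlaneBound F C m β) :
    ∫ y : ℝ, F (y * Complex.I) = 0 := by
  have hne : ∀ z : ℂ, 0 < z.re → z ≠ 0 := fun z hz h => by simp [h] at hz
  have h := hF.tendsto_integral_vertical (k := fun _ => 1)
    (B := 1) (r := 1) one_pos continuousOn_const (fun z _ => by simp)
  simp only [mul_one] at h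
  refine tendsto_nhds_unique h (Tendsto.congr' ?_ tendsto_const_nhds)
  filter_upwards [self_mem_nhdsWithin] with c hc
  have hc : 0 < c := hc
  exact (integral_vertical_eq_zero hc.le (fun z hz => (hF.diff z (hc.le.trans hz)
    (hne z (hc.trans_le hz))).differentiableWithinAt) (R₀ := 0) hF.β_pos
    (fun z hz _ => hF.far z (hc.le.trans hz) (hne z (hc.trans_le hz)))).2.symm

end

/-! ### Oscillatory integrals and size of the kernel -/

section

/-- Excluding `q = 1` avoids a logarithm. For `q < 1` the lower endpoint dominates and `δ^(q-1) ≤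
δ^(m-1)`; for `q > 1` the integral is at most `1 / (q - 1)`, and `1 ≤ δ^(m-1)`. -/
theorem integral_Ioc_rpow_le {m q δ : ℝ} (hm1 : m ≤ 1) (hq1 : q ≠ 1) (hmq : m ≤ q)
    (hδ : 0 < δ) (hδ1 : δ ≤ 1) : ∫ y in Ioc δ 1, y ^ (q - 2) ≤ |q - 1|⁻¹ * δ ^ (m - 1) := by
  have h0 : (0 : ℝ) ∉ uIcc δ 1 := by
    rw [uIcc_of_le hδ1]
    exact fun h => absurd h.1 (not_le.mpr hδ)
  rw [← intervalIntegral.integral_of_le hδ1,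
    integral_rpow (Or.inr ⟨fun h => hq1 (by linarith), h0⟩), Real.one_rpow,
    show q - 2 + 1 = q - 1 by ring]
  have hge : 1 ≤ δ ^ (m - 1) := Real.one_le_rpow_of_pos_of_le_one_of_nonpos hδ hδ1 (by linarith)
  have hqpos : 0 < δ ^ (q - 1) := by positivity
  rcases lt_or_gt_of_ne hq1 with h | h
  · have hle : δ ^ (q - 1) ≤ δ ^ (m - 1) := Real.rpow_le_rpow_of_exponent_ge hδ hδ1 (by linarith)
    rw [abs_of_neg (by linarith), ← neg_div_neg_eq, div_eq_inv_mul]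
    refine mul_le_mul_of_nonneg_left (by linarith) (inv_nonneg.mpr (by linarith))
  · rw [abs_of_pos (by linarith), div_eq_inv_mul]
    refine mul_le_mul_of_nonneg_left (by linarith) (inv_nonneg.mpr (by linarith))

/-- Decay of a Fourier integral over the half-line whose amplitude is singular at the origin. -/
theorem exists_norm_integral_oscillatory_le {φ φ' : ℝ → ℂ} {C m q β : ℝ} (hm : 0 < m)
    (hm1 : m ≤ 1) (hq1 : q ≠ 1) (hmq : m ≤ q) (hβ : 0 < β) (hC : 0 ≤ C)
    (hd : ∀ y : ℝ, 0 < y → HasDerivAt φ (φ' y) y)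
    (hb₀ : ∀ y : ℝ, 0 < y → ‖φ y‖ ≤ C * y ^ (m - 1))
    (hb₁ : ∀ y : ℝ, 0 < y → ‖φ y‖ ≤ C * y ^ (-1 - β))
    (hb₀' : ∀ y : ℝ, 0 < y → ‖φ' y‖ ≤ C * y ^ (q - 2))
    (hb₁' : ∀ y : ℝ, 0 < y → ‖φ' y‖ ≤ C * y ^ (-2 - β)) :
    ∃ K : ℝ, ∀ τ : ℝ, 1 ≤ |τ| →
      ‖∫ y in Ioi (0 : ℝ), Complex.exp (τ * y * Complex.I) * φ y‖ ≤ K * |τ| ^ (-m) := by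
  set B : ℝ := ∫ y in Ioi (1 : ℝ), y ^ (-2 - β) with hB
  have hB0 : 0 ≤ B := setIntegral_nonneg measurableSet_Ioi fun y hy => by
    have : (0 : ℝ) < y := zero_lt_one.trans hy
    positivity
  have hcont : ContinuousOn φ (Ioi 0) := fun y hy => (hd y hy).continuousAt.continuousWithinAt
  have hmeas' : AEStronglyMeasurable φ' (volume.restrict (Ioi 0)) := by
    refine (measurable_deriv φ).aestronglyMeasurable.congr ?_
    exact (ae_restrict_iff' measurableSet_Ioi).mpr
      (Eventually.of_forall fun y hy => (hd y hy).deriv)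
  have hint : IntegrableOn φ (Ioi 0) := by
    refine Integrable.mono' ((integrableOn_Ioi_min_rpow (p := m - 1) (r := -1 - β) (by linarith)
      (by linarith)).const_mul C) (hcont.aestronglyMeasurable measurableSet_Ioi) ?_
    refine (ae_restrict_iff' measurableSet_Ioi).mpr (Eventually.of_forall fun y hy => ?_)
    rw [mul_min_of_nonneg _ _ hC, abs_of_pos hy]
    exact le_min (hb₀ y hy) (hb₁ y hy)
  -- The range is cut at `δ = 1 / |τ|`. The part below `δ` gives `C / m` by absolute values. Above
  -- it, integration by parts gains a factor `δ`; the boundary term gives `C`, and the integral of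
  -- `‖φ'‖` over `(δ, 1]` and `(1, ∞)` gives the rest.
  refine ⟨C / m + C + C * (|q - 1|⁻¹ + B), fun τ hτ => ?_⟩
  have hτ0 : 0 < |τ| := by linarith
  set δ : ℝ := |τ|⁻¹ with hδ
  have hδ0 : 0 < δ := inv_pos.mpr hτ0
  have hδ1 : δ ≤ 1 := inv_le_one_of_one_le₀ hτ
  have hδm : |τ| ^ (-m) = δ ^ m := by rw [hδ, Real.inv_rpow hτ0.le, Real.rpow_neg hτ0.le]
  have hδm1 : δ * δ ^ (m - 1) = δ ^ m := by
    rw [mul_comm, ← Real.rpow_add_one hδ0.ne']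
    congr 1; ring
  have hge : 1 ≤ δ ^ (m - 1) := Real.one_le_rpow_of_pos_of_le_one_of_nonpos hδ0 hδ1 (by linarith)
  have hexp : ∀ y : ℝ, ‖Complex.exp (τ * y * Complex.I)‖ = 1 := fun y => by
    exact_mod_cast Complex.norm_exp_ofReal_mul_I (τ * y)
  have hcexp : Continuous fun y : ℝ => Complex.exp (τ * y * Complex.I) := by fun_prop
  have hsubδ : Ioi δ ⊆ Ioi (0 : ℝ) := Ioi_subset_Ioi hδ0.le
  have hinte : IntegrableOn (fun y : ℝ => Complex.exp (τ * y * Complex.I) * φ y) (Ioi 0) :=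
    hint.bdd_mul (c := 1) hcexp.aestronglyMeasurable (Eventually.of_forall fun y => (hexp y).le)
  -- the part near the origin
  have p₁ : ‖∫ y in Ioc 0 δ, Complex.exp (τ * y * Complex.I) * φ y‖ ≤ C / m * δ ^ m := by
    have hi : IntegrableOn (fun y : ℝ => C * y ^ (m - 1)) (Ioc 0 δ) :=
      ((intervalIntegrable_iff_integrableOn_Ioc_of_le hδ0.le).mp
        (intervalIntegral.intervalIntegrable_rpow' (by linarith))).const_mul C
    refine (norm_integral_le_of_norm_le hi ?_).trans (le_of_eq ?_)
    · refine (ae_restrict_iff' measurableSet_Ioc).mpr (Eventually.of_forall fun y hy => ?_)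
      rw [norm_mul, hexp, one_mul]
      exact hb₀ y hy.1
    · rw [integral_const_mul, ← intervalIntegral.integral_of_le hδ0.le,
        integral_rpow (Or.inl (by linarith)), sub_add_cancel, Real.zero_rpow hm.ne', sub_zero]
      ring
  -- the derivative
  have hi₁ : IntegrableOn (fun y : ℝ => C * y ^ (q - 2)) (Ioc δ 1) := by
    refine ((intervalIntegrable_iff_integrableOn_Ioc_of_le hδ1).mp
      (intervalIntegral.intervalIntegrable_rpow (Or.inr ?_))).const_mul C
    rw [uIcc_of_le hδ1]
    exact fun h => absurd h.1 (not_le.mpr hδ0)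
  have hi₂ : IntegrableOn (fun y : ℝ => C * y ^ (-2 - β)) (Ioi 1) :=
    (integrableOn_Ioi_rpow_of_lt (by linarith) one_pos).const_mul C
  have ae₁ : ∀ᵐ y ∂volume.restrict (Ioc δ 1), ‖φ' y‖ ≤ C * y ^ (q - 2) :=
    (ae_restrict_iff' measurableSet_Ioc).mpr (Eventually.of_forall fun y hy =>
      hb₀' y (hδ0.trans hy.1))
  have ae₂ : ∀ᵐ y ∂volume.restrict (Ioi 1), ‖φ' y‖ ≤ C * y ^ (-2 - β) :=
    (ae_restrict_iff' measurableSet_Ioi).mpr (Eventually.of_forall fun y hy =>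
      hb₁' y (zero_lt_one.trans hy))
  have j₁ : IntegrableOn φ' (Ioc δ 1) := Integrable.mono' hi₁
    (hmeas'.mono_measure (Measure.restrict_mono (fun y hy => hδ0.trans hy.1) le_rfl)) ae₁
  have j₂ : IntegrableOn φ' (Ioi 1) := Integrable.mono' hi₂
    (hmeas'.mono_measure (Measure.restrict_mono (Ioi_subset_Ioi zero_le_one) le_rfl)) ae₂
  have hint' : IntegrableOn φ' (Ioi δ) := by
    rw [← Ioc_union_Ioi_eq_Ioi hδ1]
    exact j₁.union j₂
  have hnorm' : ∫ y in Ioi δ, ‖φ' y‖ ≤ C * (|q - 1|⁻¹ + B) * δ ^ (m - 1) := by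
    rw [← Ioc_union_Ioi_eq_Ioi hδ1, setIntegral_union (Ioc_disjoint_Ioi le_rfl)
      measurableSet_Ioi j₁.norm j₂.norm]
    have k₁ := integral_mono_ae j₁.norm hi₁ ae₁
    have k₂ := integral_mono_ae j₂.norm hi₂ ae₂
    rw [integral_const_mul] at k₁ k₂
    have k₃ := mul_le_mul_of_nonneg_left (integral_Ioc_rpow_le hm1 hq1 hmq hδ0 hδ1) hC
    have k₄ : C * B ≤ C * (B * δ ^ (m - 1)) :=
      mul_le_mul_of_nonneg_left (le_mul_of_one_le_right hB0 hge) hC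
    linarith
  have hinte' : IntegrableOn (fun y : ℝ => Complex.exp (τ * y * Complex.I) * φ' y) (Ioi δ) :=
    hint'.bdd_mul (c := 1) hcexp.aestronglyMeasurable (Eventually.of_forall fun y => (hexp y).le)
  -- integration by parts
  have hder : ∀ y ∈ Ioi δ, HasDerivAt (fun y : ℝ => Complex.exp (τ * y * Complex.I) * φ y)
      (τ * Complex.I * (Complex.exp (τ * y * Complex.I) * φ y)
        + Complex.exp (τ * y * Complex.I) * φ' y) y := by
    intro y hy
    have h1 : HasDerivAt (fun y : ℝ => (τ * y * Complex.I : ℂ)) (τ * 1 * Complex.I) y :=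
      ((HasDerivAt.ofReal_comp (hasDerivAt_id y)).const_mul (τ : ℂ)).mul_const Complex.I
    refine (h1.cexp.mul (hd y (hδ0.trans hy))).congr_deriv ?_
    ring
  have hlim : Tendsto (fun y : ℝ => Complex.exp (τ * y * Complex.I) * φ y) atTop (𝓝 0) := by
    refine squeeze_zero_norm' (a := fun y : ℝ => C * y ^ (-(1 + β))) ?_ ?_
    · filter_upwards [eventually_gt_atTop 0] with y hy
      rw [norm_mul, hexp, one_mul, neg_add']
      exact hb₁ y hy
    · simpa using (tendsto_rpow_neg_atTop (by linarith : 0 < 1 + β)).const_mul C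
  have hparts := integral_Ioi_of_hasDerivAt_of_tendsto
    ((hcexp.continuousAt.mul (hd δ hδ0).continuousAt).continuousWithinAt) hder
    (((hinte.mono_set hsubδ).const_mul (τ * Complex.I)).add hinte') hlim
  rw [integral_add ((hinte.mono_set hsubδ).const_mul (τ * Complex.I)) hinte',
    integral_const_mul, zero_sub] at hparts
  have p₂ : ‖∫ y in Ioi δ, Complex.exp (τ * y * Complex.I) * φ y‖
      ≤ (C + C * (|q - 1|⁻¹ + B)) * δ ^ m := by
    set J := ∫ y in Ioi δ, Complex.exp (τ * y * Complex.I) * φ y with hJ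
    set J' := ∫ y in Ioi δ, Complex.exp (τ * y * Complex.I) * φ' y with hJ'
    have e : τ * Complex.I * J = -(Complex.exp (τ * δ * Complex.I) * φ δ) - J' := by
      rw [Pi.mul_apply] at hparts
      linear_combination hparts
    have n : |τ| * ‖J‖ = ‖(τ : ℂ) * Complex.I * J‖ := by simp
    have n' : ‖J'‖ ≤ C * (|q - 1|⁻¹ + B) * δ ^ (m - 1) := by
      refine (norm_integral_le_integral_norm _).trans ?_
      simp_rw [norm_mul, hexp, one_mul]
      exact hnorm'
    have n'' : |τ| * ‖J‖ ≤ C * δ ^ (m - 1) + C * (|q - 1|⁻¹ + B) * δ ^ (m - 1) := by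
      rw [n, e]
      refine (norm_sub_le _ _).trans (add_le_add ?_ n')
      rw [norm_neg, norm_mul, hexp, one_mul]
      exact hb₀ δ hδ0
    calc ‖J‖ = δ * (|τ| * ‖J‖) := by rw [hδ]; field_simp
      _ ≤ δ * (C * δ ^ (m - 1) + C * (|q - 1|⁻¹ + B) * δ ^ (m - 1)) := by gcongr
      _ = (C + C * (|q - 1|⁻¹ + B)) * (δ * δ ^ (m - 1)) := by ring
      _ = _ := by rw [hδm1]
  rw [hδm, ← Ioc_union_Ioi_eq_Ioi hδ0.le, setIntegral_union (Ioc_disjoint_Ioi le_rfl)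
    measurableSet_Ioi (hinte.mono_set fun y hy => hy.1) (hinte.mono_set hsubδ)]
  refine (norm_add_le _ _).trans ((add_le_add p₁ p₂).trans (le_of_eq ?_))
  ring

/-- An interpolation between the bound `|x|` for small `x` and the trivial bound `2`. -/
theorem norm_exp_sub_one_le_rpow {θ : ℝ} (h0 : 0 ≤ θ) (h1 : θ ≤ 1) (x : ℝ) :
    ‖Complex.exp (x * Complex.I) - 1‖ ≤ 2 * |x| ^ θ := by
  rcases le_or_gt |x| 1 with hx | hx
  · have h := Real.norm_exp_I_mul_ofReal_sub_one_le (x := x)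
    rw [mul_comm, Real.norm_eq_abs] at h
    rcases eq_or_ne x 0 with rfl | hne
    · simpa using Real.rpow_nonneg le_rfl θ
    have h2 : |x| ^ (1 : ℝ) ≤ |x| ^ θ :=
      Real.rpow_le_rpow_of_exponent_ge (abs_pos.mpr hne) hx h1
    rw [Real.rpow_one] at h2
    linarith [abs_nonneg x]
  · have h := norm_sub_le (Complex.exp (x * Complex.I)) 1
    rw [Complex.norm_exp_ofReal_mul_I, norm_one] at h
    linarith [Real.one_le_rpow hx.le h0]

/-- The inverse Laplace transform of `-F` as an integral over the imaginary axis. -/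
noncomputable def axisKernel (F : ℂ → ℂ) (t : ℝ) : ℂ :=
  -(2 * Real.pi : ℂ)⁻¹ * ∫ y : ℝ, Complex.exp (t * y * Complex.I) * F (y * Complex.I)

theorem norm_exp_mul_mul_I (t y : ℝ) : ‖Complex.exp (t * y * Complex.I)‖ = 1 := by
  exact_mod_cast Complex.norm_exp_ofReal_mul_I (t * y)

variable {F : ℂ → ℂ} {C m β : ℝ}

theorem HalfPlaneBound.integrable_axis (hF : HalfPlaneBound F C m β) :
    Integrable (fun y : ℝ => F (y * Complex.I)) := by
  simpa using hF.integrable_vertical le_rfl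

theorem HalfPlaneBound.integrable_exp_mul (hF : HalfPlaneBound F C m β) (t : ℝ) :
    Integrable (fun y : ℝ => Complex.exp (t * y * Complex.I) * F (y * Complex.I)) :=
  hF.integrable_axis.bdd_mul (c := 1) (Continuous.aestronglyMeasurable (by fun_prop))
    (Eventually.of_forall fun y => (norm_exp_mul_mul_I t y).le)

theorem HalfPlaneBound.continuous_axisKernel (hF : HalfPlaneBound F C m β) :
    Continuous (axisKernel F) := by
  refine continuous_const.mul (continuous_of_dominated
    (bound := fun y => ‖F (y * Complex.I)‖)
    (fun t => (hF.integrable_exp_mul t).aestronglyMeasurable) (fun t => ?_)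
    hF.integrable_axis.norm (Eventually.of_forall fun y => by fun_prop))
  refine Eventually.of_forall fun y => ?_
  rw [norm_mul, norm_exp_mul_mul_I, one_mul]

theorem exists_norm_axisKernel_le (F : ℂ → ℂ) :
    ∃ K : ℝ, ∀ t, ‖axisKernel F t‖ ≤ K := by
  refine ⟨‖-(2 * Real.pi : ℂ)⁻¹‖ * ∫ y : ℝ, ‖F (y * Complex.I)‖, fun t => ?_⟩
  rw [axisKernel, norm_mul]
  refine mul_le_mul_of_nonneg_left ((norm_integral_le_integral_norm _).trans (le_of_eq ?_))
    (norm_nonneg _)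
  simp_rw [norm_mul, norm_exp_mul_mul_I, one_mul]

/-- With `e^{ity} - 1` in place of `e^{ity}`, a factor `|ty|^(β/2)` is gained. Spending only half of
`β` leaves the integrable decay `|y|^(-1-β/2)`, and `β ≤ 2` keeps the Hölder exponent at most `1`.
This makes `axisKernel F t / t` integrable at `0`. -/
theorem HalfPlaneBound.exists_norm_axisKernel_le_rpow (hF : HalfPlaneBound F C m β)
    (hβ2 : β ≤ 2) : ∃ K : ℝ, ∀ t, ‖axisKernel F t‖ ≤ K * |t| ^ (β / 2) := by
  have hβ := hF.β_pos
  have hm := hF.m_pos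
  set D : ℝ := ∫ y : ℝ, min (|y| ^ (m - 1 + β / 2)) (|y| ^ (-1 - β / 2)) with hD
  have hDi := integrable_min_rpow (p := m - 1 + β / 2) (r := -1 - β / 2) (by linarith)
    (by linarith)
  refine ⟨‖-(2 * Real.pi : ℂ)⁻¹‖ * (2 * C * D), fun t => ?_⟩
  have e : ∫ y : ℝ, Complex.exp (t * y * Complex.I) * F (y * Complex.I)
      = ∫ y : ℝ, (Complex.exp (t * y * Complex.I) - 1) * F (y * Complex.I) := by
    simp_rw [sub_mul, one_mul]
    rw [integral_sub (hF.integrable_exp_mul t) hF.integrable_axis,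
      hF.integral_imaginary_axis_eq_zero, sub_zero]
  rw [axisKernel, norm_mul, e, mul_assoc]
  refine mul_le_mul_of_nonneg_left ?_ (norm_nonneg _)
  rw [show 2 * C * D * |t| ^ (β / 2) = 2 * C * |t| ^ (β / 2) * D by ring, hD,
    ← integral_const_mul]
  refine norm_integral_le_of_norm_le (hDi.const_mul _) ?_
  filter_upwards [ae_ne_zero] with y hy
  have hy0 : 0 < |y| := abs_pos.mpr hy
  have h1 : ‖Complex.exp (t * y * Complex.I) - 1‖ ≤ 2 * |t * y| ^ (β / 2) := by
    exact_mod_cast norm_exp_sub_one_le_rpow (by linarith) (by linarith) (t * y)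
  have h2 := hF.norm_le_min_rpow le_rfl hy
  rw [Complex.ofReal_zero, zero_add] at h2
  rw [norm_mul]
  refine (mul_le_mul h1 h2 (norm_nonneg _) (by positivity)).trans (le_of_eq ?_)
  have h3 : min (|y| ^ (m - 1 + β / 2)) (|y| ^ (-1 - β / 2))
      = |y| ^ (β / 2) * min (|y| ^ (m - 1)) (|y| ^ (-1 - β)) := by
    rw [mul_min_of_nonneg _ _ (by positivity), ← Real.rpow_add hy0, ← Real.rpow_add hy0]
    congr 2 <;> ring
  rw [h3, abs_mul, Real.mul_rpow (abs_nonneg _) (abs_nonneg _)]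
  ring

/-- The two half-axes are the rays through `u = ±i`; each gives an oscillatory integral with
frequency `±t`. -/
theorem HalfPlaneBound.exists_norm_axisKernel_le_decay (hF : HalfPlaneBound F C m β)
    {F' : ℂ → ℂ} {q : ℝ} (hq1 : q ≠ 1) (hmq : m ≤ q)
    (hd : ∀ z : ℂ, 0 ≤ z.re → z ≠ 0 → HasDerivAt F (F' z) z)
    (hb₀ : ∀ z : ℂ, 0 ≤ z.re → z ≠ 0 → ‖F' z‖ ≤ C * ‖z‖ ^ (q - 2))
    (hb₁ : ∀ z : ℂ, 0 ≤ z.re → z ≠ 0 → ‖F' z‖ ≤ C * ‖z‖ ^ (-2 - β)) :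
    ∃ K : ℝ, ∀ t, 1 ≤ t → ‖axisKernel F t‖ ≤ K * t ^ (-m) := by
  have half : ∀ u : ℂ, u.re = 0 → ‖u‖ = 1 → ∃ K : ℝ, ∀ τ : ℝ, 1 ≤ |τ| →
      ‖∫ y in Ioi (0 : ℝ), Complex.exp (τ * y * Complex.I) * F (y * u)‖ ≤ K * |τ| ^ (-m) := by
    intro u hu hu1
    have hre : ∀ y : ℝ, 0 ≤ ((y : ℂ) * u).re := fun y => by simp [hu]
    have hne : ∀ y : ℝ, 0 < y → (y : ℂ) * u ≠ 0 := fun y hy =>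
      mul_ne_zero (by exact_mod_cast hy.ne') (norm_ne_zero_iff.mp (by rw [hu1]; exact one_ne_zero))
    have hn : ∀ y : ℝ, 0 < y → ‖(y : ℂ) * u‖ = y := fun y hy => by
      rw [norm_mul, hu1, mul_one, Complex.norm_of_nonneg hy.le]
    refine exists_norm_integral_oscillatory_le (φ' := fun y => F' (y * u) * u) hF.m_pos hF.m_le
      hq1 hmq hF.β_pos hF.C_nonneg ?_ ?_ ?_ ?_ ?_
    · intro y hy
      have h1 : HasDerivAt (fun y : ℝ => (y * u : ℂ)) (1 * u) y :=
        (HasDerivAt.ofReal_comp (hasDerivAt_id y)).mul_const u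
      rw [one_mul] at h1
      exact (hd _ (hre y) (hne y hy)).comp y h1
    · intro y hy
      simpa only [hn y hy] using hF.near _ (hre y) (hne y hy)
    · intro y hy
      simpa only [hn y hy] using hF.far _ (hre y) (hne y hy)
    · intro y hy
      rw [norm_mul, hu1, mul_one]
      simpa only [hn y hy] using hb₀ _ (hre y) (hne y hy)
    · intro y hy
      rw [norm_mul, hu1, mul_one]
      simpa only [hn y hy] using hb₁ _ (hre y) (hne y hy)
  obtain ⟨K₁, h₁⟩ := half Complex.I (by simp) (by simp)
  obtain ⟨K₂, h₂⟩ := half (-Complex.I) (by simp) (by simp)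
  refine ⟨‖-(2 * Real.pi : ℂ)⁻¹‖ * (K₂ + K₁), fun t ht => ?_⟩
  have hi := hF.integrable_exp_mul t
  rw [axisKernel, norm_mul, mul_assoc]
  refine mul_le_mul_of_nonneg_left ?_ (norm_nonneg _)
  have hat : |t| = t := abs_of_pos (by linarith)
  rw [← setIntegral_univ, ← Iic_union_Ioi (a := (0 : ℝ)), setIntegral_union
    (Iic_disjoint_Ioi le_rfl) measurableSet_Ioi hi.integrableOn hi.integrableOn, add_mul]
  refine (norm_add_le _ _).trans (add_le_add ?_ ?_)
  · have h := h₂ (-t) (by rwa [abs_neg, hat])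
    rw [abs_neg, hat] at h
    have e := integral_comp_neg_Ioi (0 : ℝ)
      (fun y : ℝ => Complex.exp (t * y * Complex.I) * F (y * Complex.I))
    rw [neg_zero] at e
    rw [← e]
    have e' : ∀ y : ℝ, Complex.exp (t * (-y : ℝ) * Complex.I) * F ((-y : ℝ) * Complex.I)
        = Complex.exp ((-t : ℝ) * y * Complex.I) * F (y * -Complex.I) := fun y => by
      congr 2
      · push_cast
        ring
      · push_cast
        ring
    simp_rw [e']
    exact h
  · have h := h₁ t (by rwa [hat])
    rwa [hat] at h

end

/-! ### Laplace inversion through the derivative -/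

section

variable {F : ℂ → ℂ} {C m β : ℝ}

/-- The substitution `y ↦ -y` identifies the integral with its conjugate. -/
theorem axisKernel_ofReal_re
    (hconj : ∀ y : ℝ, F (-(y * Complex.I)) = (starRingEnd ℂ) (F (y * Complex.I))) (t : ℝ) :
    ((axisKernel F t).re : ℂ) = axisKernel F t := by
  rw [← Complex.conj_eq_iff_re, axisKernel, map_mul, ← integral_conj,
    ← integral_neg_eq_self (fun y : ℝ => Complex.exp (t * y * Complex.I) * F (y * Complex.I))]
  congr 1
  · simp [Complex.conj_ofNat]
  · refine integral_congr_ae (Eventually.of_forall fun y => ?_)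
    simp only [map_mul, ← Complex.exp_conj, Complex.conj_ofReal, Complex.conj_I, ← hconj,
      Complex.ofReal_neg, neg_mul, mul_neg]

/-- By Fubini the `t`-integral is done first and produces `1 / (s - iy)`, the Cauchy kernel on the
axis. -/
theorem HalfPlaneBound.laplace_axisKernel (hF : HalfPlaneBound F C m β) {s : ℂ} (hs : 0 < s.re) :
    ∫ t in Ioi (0 : ℝ), Complex.exp (-s * t) * axisKernel F t = -F s := by
  have hexp : IntegrableOn (fun t : ℝ => Complex.exp (-s * t)) (Ioi 0) :=
    integrableOn_exp_mul_complex_Ioi (by simpa using hs) 0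
  have hprod : Integrable (Function.uncurry fun (t y : ℝ) =>
      Complex.exp (t * y * Complex.I) * (Complex.exp (-s * t) * F (y * Complex.I)))
      ((volume.restrict (Ioi 0)).prod volume) := by
    refine (hexp.mul_prod hF.integrable_axis).bdd_mul (c := 1)
      (Continuous.aestronglyMeasurable (by fun_prop)) (Eventually.of_forall fun p => ?_)
    exact (norm_exp_mul_mul_I p.1 p.2).le
  have e : ∀ t : ℝ, Complex.exp (-s * t) * axisKernel F t = -(2 * Real.pi : ℂ)⁻¹ *
      ∫ y : ℝ, Complex.exp (t * y * Complex.I) * (Complex.exp (-s * t) * F (y * Complex.I)) := by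
    intro t
    rw [axisKernel, mul_left_comm, ← integral_const_mul]
    congr 2
    funext y
    ring
  simp_rw [e]
  rw [integral_const_mul, integral_integral_swap hprod]
  have inner : ∀ y : ℝ, ∫ t in Ioi (0 : ℝ),
      Complex.exp (t * y * Complex.I) * (Complex.exp (-s * t) * F (y * Complex.I))
      = F (y * Complex.I) * (1 / (s - y * Complex.I)) := by
    intro y
    have h := integral_exp_mul_complex_Ioi (a := -(s - y * Complex.I)) (by simpa using hs) 0
    have e2 : ∀ t : ℝ, Complex.exp (t * y * Complex.I) * (Complex.exp (-s * t) * F (y * Complex.I))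
        = F (y * Complex.I) * Complex.exp (-(s - y * Complex.I) * t) := by
      intro t
      rw [← mul_assoc, ← Complex.exp_add, mul_comm]
      congr 2
      ring
    simp_rw [e2]
    rw [integral_const_mul, h, Complex.ofReal_zero, mul_zero, Complex.exp_zero, neg_div_neg_eq]
  simp_rw [inner]
  rw [hF.cauchy_imaginary_axis hs]
  have : (Real.pi : ℂ) ≠ 0 := by exact_mod_cast Real.pi_ne_zero
  field_simp

theorem norm_exp_neg_mul (s : ℂ) (t : ℝ) : ‖Complex.exp (-s * t)‖ = Real.exp (-s.re * t) := by
  rw [Complex.norm_exp]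
  simp

theorem integrableOn_laplace {f : ℝ → ℝ} (hf : IntegrableOn f (Ioi 0)) {s : ℂ} (hs : 0 ≤ s.re) :
    IntegrableOn (fun t : ℝ => Complex.exp (-s * t) * (f t : ℂ)) (Ioi 0) := by
  refine hf.ofReal.bdd_mul (c := 1) (Continuous.aestronglyMeasurable (by fun_prop)) ?_
  refine (ae_restrict_iff' measurableSet_Ioi).mpr (Eventually.of_forall fun t ht => ?_)
  rw [norm_exp_neg_mul, Real.exp_le_one_iff]
  have : 0 < t := ht
  nlinarith

/-- Fixes the constant of integration when a transform is recovered from its derivative. -/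
theorem tendsto_laplace_atTop {f : ℝ → ℝ} (hf : IntegrableOn f (Ioi 0)) :
    Tendsto (fun x : ℝ => ∫ t in Ioi (0 : ℝ), Complex.exp (-(x : ℂ) * t) * (f t : ℂ)) atTop
      (𝓝 0) := by
  have h := tendsto_integral_filter_of_dominated_convergence (μ := volume.restrict (Ioi (0 : ℝ)))
    (F := fun (x t : ℝ) => Complex.exp (-(x : ℂ) * t) * (f t : ℂ)) (f := fun _ => (0 : ℂ))
    (l := atTop) (fun t => |f t|) ?_ ?_ hf.abs ?_
  · simpa using h
  · filter_upwards [eventually_ge_atTop 0] with x hx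
    exact (integrableOn_laplace hf (s := x) (by simpa using hx)).aestronglyMeasurable
  · filter_upwards [eventually_ge_atTop 0] with x hx
    refine (ae_restrict_iff' measurableSet_Ioi).mpr (Eventually.of_forall fun t ht => ?_)
    have ht : 0 < t := ht
    rw [norm_mul, norm_exp_neg_mul, Complex.norm_real, Real.norm_eq_abs, Complex.ofReal_re]
    refine mul_le_of_le_one_left (abs_nonneg _) ?_
    rw [Real.exp_le_one_iff]
    nlinarith
  · refine (ae_restrict_iff' measurableSet_Ioi).mpr (Eventually.of_forall fun t ht => ?_)
    have ht : 0 < t := ht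
    rw [tendsto_zero_iff_norm_tendsto_zero]
    simp_rw [norm_mul, norm_exp_neg_mul, Complex.ofReal_re]
    have : Tendsto (fun x : ℝ => Real.exp (-x * t)) atTop (𝓝 0) := by
      refine Real.tendsto_exp_atBot.comp ?_
      simp_rw [neg_mul]
      exact tendsto_neg_atTop_atBot.comp (tendsto_id.atTop_mul_const ht)
    simpa using this.mul_const ‖(f t : ℂ)‖

theorem hasDerivAt_laplace {f : ℝ → ℝ} (hf : IntegrableOn f (Ioi 0)) {K : ℝ}
    (hK : ∀ t : ℝ, 0 < t → |t * f t| ≤ K) {s : ℂ} (hs : 0 < s.re) :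
    HasDerivAt (fun z : ℂ => ∫ t in Ioi (0 : ℝ), Complex.exp (-z * t) * (f t : ℂ))
      (∫ t in Ioi (0 : ℝ), -(Complex.exp (-s * t) * ((t * f t : ℝ) : ℂ))) s := by
  have hopen : IsOpen {z : ℂ | s.re / 2 < z.re} := isOpen_lt continuous_const Complex.continuous_re
  have hmem : {z : ℂ | s.re / 2 < z.re} ∈ 𝓝 s := hopen.mem_nhds (half_lt_self hs)
  refine (hasDerivAt_integral_of_dominated_loc_of_deriv_le
    (F := fun (z : ℂ) (t : ℝ) => Complex.exp (-z * t) * (f t : ℂ))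
    (F' := fun (z : ℂ) (t : ℝ) => -(Complex.exp (-z * t) * ((t * f t : ℝ) : ℂ)))
    (μ := volume.restrict (Ioi 0)) (bound := fun t => Real.exp (-(s.re / 2) * t) * K) hmem ?_ (integrableOn_laplace hf hs.le)
    ?_ ?_ ?_ ?_).2
  · filter_upwards [hmem] with z hz
    exact (integrableOn_laplace hf (le_of_lt ((half_pos hs).trans hz))).aestronglyMeasurable
  · refine (AEStronglyMeasurable.mul (Continuous.aestronglyMeasurable (by fun_prop)) ?_).neg
    exact (Complex.continuous_ofReal.comp_aestronglyMeasurable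
      (continuous_id.aestronglyMeasurable.mul hf.aestronglyMeasurable))
  · refine (ae_restrict_iff' measurableSet_Ioi).mpr (Eventually.of_forall fun t ht z hz => ?_)
    have ht : 0 < t := ht
    have hz : s.re / 2 < z.re := hz
    rw [norm_neg, norm_mul, norm_exp_neg_mul, Complex.norm_real, Real.norm_eq_abs]
    refine mul_le_mul (Real.exp_le_exp.mpr ?_) (hK t ht) (abs_nonneg _) (Real.exp_pos _).le
    nlinarith
  · exact (integrableOn_exp_mul_Ioi (by linarith) 0).mul_const K
  · refine Eventually.of_forall fun t z _ => ?_
    have h1 : HasDerivAt (fun z : ℂ => -z * (t : ℂ)) (-1 * t) z :=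
      (hasDerivAt_id z).neg.mul_const (t : ℂ)
    refine (h1.cexp.mul_const (f t : ℂ)).congr_deriv ?_
    push_cast
    ring

/-- A function `G` whose derivative satisfies power bounds on the closed right half-plane has an
integrable inverse Laplace transform, which decays like `t ^ (-1 - m)`. -/
theorem exists_isInverseLaplace {G G₁ G₂ : ℂ → ℂ} {q : ℝ} (hG₁ : HalfPlaneBound G₁ C m β)
    (hβ2 : β ≤ 2) (hG : ∀ z : ℂ, 0 < z.re → HasDerivAt G (G₁ z) z)
    (hlim : Tendsto (fun x : ℝ => G x) atTop (𝓝 0)) (hq1 : q ≠ 1) (hmq : m ≤ q)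
    (hd : ∀ z : ℂ, 0 ≤ z.re → z ≠ 0 → HasDerivAt G₁ (G₂ z) z)
    (hb₀ : ∀ z : ℂ, 0 ≤ z.re → z ≠ 0 → ‖G₂ z‖ ≤ C * ‖z‖ ^ (q - 2))
    (hb₁ : ∀ z : ℂ, 0 ≤ z.re → z ≠ 0 → ‖G₂ z‖ ≤ C * ‖z‖ ^ (-2 - β))
    (hconj : ∀ y : ℝ, G₁ (-(y * Complex.I)) = (starRingEnd ℂ) (G₁ (y * Complex.I))) :
    ∃ f : ℝ → ℝ, IsInverseLaplace G f ∧ IntegrableOn f (Ioi 0) ∧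
      ∃ K : ℝ, ∀ t : ℝ, 1 ≤ t → |f t| ≤ K * t ^ (-1 - m) := by
  have hβ := hG₁.β_pos
  have hm := hG₁.m_pos
  -- `-G₁ = -G'` is to be the transform of `t * f t`, so `h` is `t * f t` and `f` is recovered by
  -- division.
  set h : ℝ → ℝ := fun t => (axisKernel G₁ t).re with hh
  have hhc : Continuous h := Complex.continuous_re.comp hG₁.continuous_axisKernel
  have habs : ∀ t, |h t| ≤ ‖axisKernel G₁ t‖ := fun t => Complex.abs_re_le_norm _
  obtain ⟨K₀, hK₀⟩ := exists_norm_axisKernel_le G₁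
  obtain ⟨K₁, hK₁⟩ := hG₁.exists_norm_axisKernel_le_rpow hβ2
  obtain ⟨K₂, hK₂⟩ := hG₁.exists_norm_axisKernel_le_decay hq1 hmq hd hb₀ hb₁
  set f : ℝ → ℝ := (Ioi (0 : ℝ)).indicator fun t => h t / t with hf
  have hft : ∀ t, 0 < t → f t = h t / t := fun t ht => indicator_of_mem (mem_Ioi.mpr ht) _
  have htf : ∀ t, 0 < t → t * f t = h t := fun t ht => by
    rw [hft t ht]
    field_simp
  have hcont : ContinuousOn f (Ioi 0) := by
    refine ContinuousOn.congr (f := fun t => h t / t) ?_ (fun t ht => hft t ht)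
    exact hhc.continuousOn.div continuousOn_id fun t ht => ne_of_gt ht
  have hdecay : ∀ t, 1 ≤ t → |f t| ≤ K₂ * t ^ (-1 - m) := by
    intro t ht
    have ht0 : 0 < t := by linarith
    rw [hft t ht0, abs_div, abs_of_pos ht0, div_le_iff₀ ht0, mul_assoc,
      ← Real.rpow_add_one ht0.ne', show -1 - m + 1 = -m by ring]
    exact (habs t).trans (hK₂ t ht)
  have hsmall : ∀ t, 0 < t → |f t| ≤ K₁ * t ^ (β / 2 - 1) := by
    intro t ht0
    rw [hft t ht0, abs_div, abs_of_pos ht0, div_le_iff₀ ht0, mul_assoc,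
      ← Real.rpow_add_one ht0.ne', sub_add_cancel]
    have := (habs t).trans (hK₁ t)
    rwa [abs_of_pos ht0] at this
  have hfint : IntegrableOn f (Ioi 0) := by
    rw [← Ioc_union_Ioi_eq_Ioi (zero_le_one : (0 : ℝ) ≤ 1)]
    refine IntegrableOn.union ?_ ?_
    · have hi := ((intervalIntegrable_iff_integrableOn_Ioc_of_le zero_le_one).mp
        (intervalIntegral.intervalIntegrable_rpow' (a := 0) (b := 1)
          (by linarith : -1 < β / 2 - 1))).const_mul K₁
      refine Integrable.mono' hi ((hcont.mono Ioc_subset_Ioi_self).aestronglyMeasurable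
        measurableSet_Ioc) ?_
      exact (ae_restrict_iff' measurableSet_Ioc).mpr
        (Eventually.of_forall fun t ht => hsmall t ht.1)
    · have hi := (integrableOn_Ioi_rpow_of_lt (by linarith : -1 - m < -1) one_pos).const_mul K₂
      refine Integrable.mono' hi ((hcont.mono (Ioi_subset_Ioi zero_le_one)).aestronglyMeasurable
        measurableSet_Ioi) ?_
      exact (ae_restrict_iff' measurableSet_Ioi).mpr
        (Eventually.of_forall fun t ht => hdecay t (le_of_lt ht))
  refine ⟨f, ⟨fun t ht => indicator_of_notMem (notMem_Ioi.mpr ht) _, hcont, 0, fun s hs =>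
    ⟨integrableOn_laplace hfint hs.le, ?_⟩⟩, hfint, K₂, hdecay⟩
  -- The transform of `f` and `G` have the same derivative on the connected set `H`, so they differ
  -- by a constant; it is zero because both tend to `0` along the positive reals.
  set H : Set ℂ := {z : ℂ | 0 < z.re} with hH
  have hopen : IsOpen H := isOpen_lt continuous_const Complex.continuous_re
  have hder : ∀ z ∈ H, HasDerivAt (fun z : ℂ =>
      (∫ t in Ioi (0 : ℝ), Complex.exp (-z * t) * (f t : ℂ)) - G z) 0 z := by
    intro z hz
    have h1 := hasDerivAt_laplace hfint (K := K₀)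
      (fun t ht => by rw [htf t ht]; exact (habs t).trans (hK₀ t)) hz
    refine (h1.sub (hG z hz)).congr_deriv ?_
    rw [integral_neg, sub_eq_zero, neg_eq_iff_eq_neg, ← hG₁.laplace_axisKernel hz]
    refine setIntegral_congr_fun measurableSet_Ioi fun t ht => ?_
    rw [htf t ht, hh, axisKernel_ofReal_re hconj]
  obtain ⟨a, ha⟩ := hopen.exists_is_const_of_deriv_eq_zero
    (convex_halfSpace_re_gt 0).isPreconnected
    (fun z hz => (hder z hz).differentiableAt.differentiableWithinAt)
    (fun z hz => (hder z hz).deriv)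
  have hl := (tendsto_laplace_atTop hfint).sub hlim
  rw [sub_zero] at hl
  have ha0 : a = 0 := by
    refine tendsto_nhds_unique (Tendsto.congr' ?_ tendsto_const_nhds) hl
    filter_upwards [eventually_gt_atTop 0] with x hx
    exact (ha x (by simpa [hH] using hx)).symm
  exact sub_eq_zero.mp ((ha s hs).trans ha0)

end

/-! ### Power bounds on the closed right half-plane -/

section

/-- The principal power `z ^ x` with a real exponent. -/
noncomputable def realPow (x : ℝ) (z : ℂ) : ℂ := z ^ (x : ℂ)

/-- On the closed right half-plane, `u` is bounded by a multiple of `|z| ^ p` for `|z| ≤ 1` and of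
`|z| ^ r` for `|z| ≥ 1`. -/
def PowBound (p r : ℝ) (u : ℂ → ℂ) : Prop :=
  ∃ C : ℝ, 0 ≤ C ∧ ∀ z : ℂ, 0 ≤ z.re → z ≠ 0 →
    (‖z‖ ≤ 1 → ‖u z‖ ≤ C * ‖z‖ ^ p) ∧ (1 ≤ ‖z‖ → ‖u z‖ ≤ C * ‖z‖ ^ r)

namespace PowBound

variable {p p' r r' : ℝ} {u v : ℂ → ℂ}

theorem mono (h : PowBound p r u) (hp : p' ≤ p) (hr : r ≤ r') : PowBound p' r' u := by
  obtain ⟨C, hC, h⟩ := h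
  refine ⟨C, hC, fun z hz hz0 => ⟨fun h1 => ((h z hz hz0).1 h1).trans ?_,
    fun h1 => ((h z hz hz0).2 h1).trans ?_⟩⟩
  · exact mul_le_mul_of_nonneg_left
      (Real.rpow_le_rpow_of_exponent_ge (norm_pos_iff.mpr hz0) h1 hp) hC
  · exact mul_le_mul_of_nonneg_left (Real.rpow_le_rpow_of_exponent_le h1 hr) hC

theorem add (hu : PowBound p r u) (hv : PowBound p r v) : PowBound p r fun z => u z + v z := by
  obtain ⟨C, hC, hu⟩ := hu
  obtain ⟨D, hD, hv⟩ := hv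
  refine ⟨C + D, by positivity, fun z hz hz0 => ⟨fun h1 => ?_, fun h1 => ?_⟩⟩
  · rw [add_mul]
    exact norm_add_le_of_le ((hu z hz hz0).1 h1) ((hv z hz hz0).1 h1)
  · rw [add_mul]
    exact norm_add_le_of_le ((hu z hz hz0).2 h1) ((hv z hz hz0).2 h1)

theorem mul (hu : PowBound p r u) (hv : PowBound p' r' v) :
    PowBound (p + p') (r + r') fun z => u z * v z := by
  obtain ⟨C, hC, hu⟩ := hu
  obtain ⟨D, hD, hv⟩ := hv
  refine ⟨C * D, by positivity, fun z hz hz0 => ⟨fun h1 => ?_, fun h1 => ?_⟩⟩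
  · rw [norm_mul, Real.rpow_add (norm_pos_iff.mpr hz0), mul_mul_mul_comm]
    exact mul_le_mul ((hu z hz hz0).1 h1) ((hv z hz hz0).1 h1) (norm_nonneg _) (by positivity)
  · rw [norm_mul, Real.rpow_add (norm_pos_iff.mpr hz0), mul_mul_mul_comm]
    exact mul_le_mul ((hu z hz hz0).2 h1) ((hv z hz hz0).2 h1) (norm_nonneg _) (by positivity)

theorem const_mul (hu : PowBound p r u) (c : ℂ) : PowBound p r fun z => c * u z := by
  obtain ⟨C, hC, hu⟩ := hu
  refine ⟨‖c‖ * C, by positivity, fun z hz hz0 => ⟨fun h1 => ?_, fun h1 => ?_⟩⟩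
  · rw [norm_mul, mul_assoc]
    exact mul_le_mul_of_nonneg_left ((hu z hz hz0).1 h1) (norm_nonneg _)
  · rw [norm_mul, mul_assoc]
    exact mul_le_mul_of_nonneg_left ((hu z hz hz0).2 h1) (norm_nonneg _)

theorem sub (hu : PowBound p r u) (hv : PowBound p r v) : PowBound p r fun z => u z - v z := by
  simpa only [neg_one_mul, ← sub_eq_add_neg] using hu.add (hv.const_mul (-1))

theorem realPow (x : ℝ) : PowBound x x (realPow x) :=
  ⟨1, zero_le_one, fun z _ _ => by simp [FracPlanar.realPow, Complex.norm_cpow_real]⟩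

/-- The alternative `c = 0` admits a power too singular at the origin when differentiation has
annihilated its coefficient, as happens for exponents `0` and `1`. -/
theorem const_mul_realPow {c x : ℝ} (h : c = 0 ∨ p ≤ x) (hr : x ≤ r) :
    PowBound p r fun z => (c : ℂ) * FracPlanar.realPow x z := by
  rcases h with rfl | h
  · exact ⟨0, le_rfl, fun z _ _ => by simp⟩
  · exact ((realPow x).mono h hr).const_mul _

theorem exists_norm_le (hu : PowBound p r u) (hrp : r ≤ p) :
    ∃ C : ℝ, 0 ≤ C ∧ ∀ z : ℂ, 0 ≤ z.re → z ≠ 0 → ‖u z‖ ≤ C * ‖z‖ ^ p ∧ ‖u z‖ ≤ C * ‖z‖ ^ r := by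
  obtain ⟨C, hC, hu⟩ := hu
  refine ⟨C, hC, fun z hz hz0 => ?_⟩
  rcases le_total ‖z‖ 1 with h1 | h1
  · have h2 := (hu z hz hz0).1 h1
    exact ⟨h2, h2.trans (mul_le_mul_of_nonneg_left
      (Real.rpow_le_rpow_of_exponent_ge (norm_pos_iff.mpr hz0) h1 hrp) hC)⟩
  · have h2 := (hu z hz hz0).2 h1
    exact ⟨h2.trans (mul_le_mul_of_nonneg_left
      (Real.rpow_le_rpow_of_exponent_le h1 hrp) hC), h2⟩

end PowBound

theorem mem_slitPlane_of_re_nonneg {z : ℂ} (hz : 0 ≤ z.re) (hz0 : z ≠ 0) :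
    z ∈ Complex.slitPlane := by
  rw [Complex.mem_slitPlane_iff]
  by_contra! h
  exact hz0 (Complex.ext (le_antisymm h.1 hz) h.2)

theorem hasDerivAt_realPow (x : ℝ) {z : ℂ} (hz : 0 ≤ z.re) (hz0 : z ≠ 0) :
    HasDerivAt (realPow x) (x * realPow (x - 1) z) z := by
  have h := (hasDerivAt_id z).cpow_const (c := (x : ℂ)) (mem_slitPlane_of_re_nonneg hz hz0)
  refine h.congr_deriv ?_
  simp [realPow]

theorem realPow_conj (x : ℝ) {z : ℂ} (hz : 0 ≤ z.re) :
    realPow x ((starRingEnd ℂ) z) = (starRingEnd ℂ) (realPow x z) := by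
  rw [realPow, Complex.conj_cpow _ _ fun h => by
    have := (Complex.arg_eq_pi_iff.mp h).1
    linarith, Complex.conj_ofReal, realPow]

/-! ### Estimates for `Q`, for the symbol and for its derivatives -/

section Symbol

variable (a b : ℝ) (A : Matrix (Fin 2) (Fin 2) ℝ)

/-- The derivative of `Q`. -/
noncomputable def derivQ (z : ℂ) : ℂ :=
  ((a + b : ℝ) : ℂ) * realPow (a + b - 1) z - ((A 0 0 * b : ℝ) : ℂ) * realPow (b - 1) z
    - ((A 1 1 * a : ℝ) : ℂ) * realPow (a - 1) z

/-- The second derivative of `Q`. -/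
noncomputable def derivQ₂ (z : ℂ) : ℂ :=
  (((a + b) * (a + b - 1) : ℝ) : ℂ) * realPow (a + b - 2) z
    - ((A 0 0 * b * (b - 1) : ℝ) : ℂ) * realPow (b - 2) z
    - ((A 1 1 * a * (a - 1) : ℝ) : ℂ) * realPow (a - 2) z

theorem Q_eq (z : ℂ) : Q a b A z = realPow (a + b) z - (A 0 0 : ℂ) * realPow b z
    - (A 1 1 : ℂ) * realPow a z + (A.det : ℂ) := rfl

variable {a b A}

theorem hasDerivAt_Q {z : ℂ} (hz : 0 ≤ z.re) (hz0 : z ≠ 0) :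
    HasDerivAt (Q a b A) (derivQ a b A z) z := by
  have h := (((hasDerivAt_realPow (a + b) hz hz0).sub
    ((hasDerivAt_realPow b hz hz0).const_mul (A 0 0 : ℂ))).sub
    ((hasDerivAt_realPow a hz hz0).const_mul (A 1 1 : ℂ))).add_const (A.det : ℂ)
  refine HasDerivAt.congr_deriv (f := Q a b A) h ?_
  rw [derivQ]
  push_cast
  ring

theorem hasDerivAt_derivQ {z : ℂ} (hz : 0 ≤ z.re) (hz0 : z ≠ 0) :
    HasDerivAt (derivQ a b A) (derivQ₂ a b A z) z := by
  have h := (((hasDerivAt_realPow (a + b - 1) hz hz0).const_mul ((a + b : ℝ) : ℂ)).sub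
    ((hasDerivAt_realPow (b - 1) hz hz0).const_mul ((A 0 0 * b : ℝ) : ℂ))).sub
    ((hasDerivAt_realPow (a - 1) hz hz0).const_mul ((A 1 1 * a : ℝ) : ℂ))
  refine HasDerivAt.congr_deriv (f := derivQ a b A) h ?_
  rw [derivQ₂, show a + b - 1 - 1 = a + b - 2 by ring, show b - 1 - 1 = b - 2 by ring,
    show a - 1 - 1 = a - 2 by ring]
  push_cast
  ring

theorem Q_conj {z : ℂ} (hz : 0 ≤ z.re) :
    Q a b A ((starRingEnd ℂ) z) = (starRingEnd ℂ) (Q a b A z) := by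
  simp [Q_eq, realPow_conj _ hz]

theorem derivQ_conj {z : ℂ} (hz : 0 ≤ z.re) :
    derivQ a b A ((starRingEnd ℂ) z) = (starRingEnd ℂ) (derivQ a b A z) := by
  simp [derivQ, realPow_conj _ hz]

theorem continuousOn_Q (ha : 0 < a) (hb : 0 < b) : ContinuousOn (Q a b A) {z | 0 ≤ z.re} := by
  have h : ∀ x : ℝ, 0 < x → ContinuousOn (realPow x) {z | 0 ≤ z.re} := fun x hx z hz =>
    (Complex.continuousAt_cpow_const_of_re_pos (Or.inl hz) (by simpa using hx)).continuousWithinAt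
  have h1 := h (a + b) (by linarith)
  have h2 := h a ha
  have h3 := h b hb
  exact ((h1.sub (continuousOn_const.mul h3)).sub (continuousOn_const.mul h2)).add
    continuousOn_const

/-- For large `‖z‖` the leading power outweighs the other terms. On the remaining compact half-disc
`Q` is continuous, also at the origin since the exponents are positive, and has no zero, so its
modulus has a positive minimum. -/
theorem exists_le_norm_Q (ha : 0 < a) (hb : 0 < b) (hQ : ∀ s : ℂ, Q a b A s = 0 → s.re < 0) :
    ∃ c : ℝ, 0 < c ∧ ∀ z : ℂ, 0 ≤ z.re → c * (max 1 ‖z‖) ^ (a + b) ≤ ‖Q a b A z‖ := by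
  have hlim : Tendsto (fun x : ℝ => |A 0 0| * x ^ (-a) + |A 1 1| * x ^ (-b)
      + |A.det| * x ^ (-(a + b))) atTop (𝓝 0) := by
    have := (((tendsto_rpow_neg_atTop ha).const_mul |A 0 0|).add
      ((tendsto_rpow_neg_atTop hb).const_mul |A 1 1|)).add
      ((tendsto_rpow_neg_atTop (add_pos ha hb)).const_mul |A.det|)
    simpa using this
  obtain ⟨R₁, hR₁⟩ := eventually_atTop.mp
    (hlim.eventually (Iic_mem_nhds (by norm_num : (0 : ℝ) < 1 / 2)))
  set R := max 1 R₁ with hR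
  have hR1 : 1 ≤ R := le_max_left _ _
  have hfar : ∀ z : ℂ, R ≤ ‖z‖ → 1 / 2 * ‖z‖ ^ (a + b) ≤ ‖Q a b A z‖ := by
    intro z hz
    have hz0 : 0 < ‖z‖ := by linarith
    have h := hR₁ ‖z‖ ((le_max_right _ _).trans hz)
    have h2 := mul_le_mul_of_nonneg_right h (by positivity : 0 ≤ ‖z‖ ^ (a + b))
    rw [add_mul, add_mul, mul_assoc, mul_assoc, mul_assoc, ← Real.rpow_add hz0,
      ← Real.rpow_add hz0, ← Real.rpow_add hz0, show -a + (a + b) = b by ring,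
      show -b + (a + b) = a by ring, show -(a + b) + (a + b) = 0 by ring, Real.rpow_zero,
      mul_one] at h2
    have e : realPow (a + b) z = Q a b A z + (A 0 0 : ℂ) * realPow b z
        + (A 1 1 : ℂ) * realPow a z - (A.det : ℂ) := by rw [Q_eq]; ring
    have hn : ∀ x : ℝ, ‖realPow x z‖ = ‖z‖ ^ x := fun x => Complex.norm_cpow_real z x
    have h3 : ‖z‖ ^ (a + b) ≤ ‖Q a b A z‖ + |A 0 0| * ‖z‖ ^ b + |A 1 1| * ‖z‖ ^ a + |A.det| := by
      rw [← hn (a + b), e]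
      refine (norm_sub_le _ _).trans (add_le_add (norm_add₃_le.trans (le_of_eq ?_)) ?_)
      · rw [norm_mul, norm_mul, hn, hn, Complex.norm_real, Complex.norm_real, Real.norm_eq_abs,
          Real.norm_eq_abs]
      · rw [Complex.norm_real, Real.norm_eq_abs]
    linarith
  have hK : IsCompact (Metric.closedBall (0 : ℂ) R ∩ {z | 0 ≤ z.re}) :=
    (isCompact_closedBall 0 R).inter_right (isClosed_le continuous_const Complex.continuous_re)
  obtain ⟨z₀, hz₀, hmin⟩ := hK.exists_isMinOn (f := fun z => ‖Q a b A z‖)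
    ⟨0, by simp; linarith⟩ ((continuousOn_Q ha hb).mono inter_subset_right).norm
  have hpos : 0 < ‖Q a b A z₀‖ := norm_pos_iff.mpr fun h => by
    have h1 := hQ z₀ h
    have h2 : 0 ≤ z₀.re := hz₀.2
    linarith
  have hRpos : 0 < R ^ (a + b) := by positivity
  refine ⟨min (‖Q a b A z₀‖ / R ^ (a + b)) (1 / 2), by positivity, fun z hz => ?_⟩
  rcases le_total R ‖z‖ with h | h
  · rw [max_eq_right (hR1.trans h)]
    exact (mul_le_mul_of_nonneg_right (min_le_right _ _) (by positivity)).trans (hfar z h)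
  · have h1 : (max 1 ‖z‖) ^ (a + b) ≤ R ^ (a + b) :=
      Real.rpow_le_rpow (by positivity) (max_le hR1 h) (by linarith)
    calc min (‖Q a b A z₀‖ / R ^ (a + b)) (1 / 2) * (max 1 ‖z‖) ^ (a + b)
        ≤ ‖Q a b A z₀‖ / R ^ (a + b) * R ^ (a + b) :=
          mul_le_mul (min_le_left _ _) h1 (by positivity) (by positivity)
      _ = ‖Q a b A z₀‖ := by field_simp
      _ ≤ ‖Q a b A z‖ := hmin ⟨by simpa using h, hz⟩

theorem powBound_inv_Q (ha : 0 < a) (hb : 0 < b) (hQ : ∀ s : ℂ, Q a b A s = 0 → s.re < 0) :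
    PowBound 0 (-(a + b)) fun z => (Q a b A z)⁻¹ := by
  obtain ⟨c, hc, h⟩ := exists_le_norm_Q ha hb hQ
  refine ⟨c⁻¹, (inv_pos.mpr hc).le, fun z hz hz0 => ⟨fun h1 => ?_, fun h1 => ?_⟩⟩
  · have h2 := h z hz
    rw [max_eq_left h1, Real.one_rpow, mul_one] at h2
    rw [Real.rpow_zero, mul_one, norm_inv]
    exact inv_anti₀ hc h2
  · have h2 := h z hz
    rw [max_eq_right h1] at h2
    rw [Real.rpow_neg (norm_nonneg _), ← mul_inv, norm_inv]
    exact inv_anti₀ (mul_pos hc (Real.rpow_pos_of_pos (norm_pos_iff.mpr hz0) _)) h2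

variable (a b A) (γ : ℝ)

/-- The derivative of `z ^ γ / Q z`. -/
noncomputable def derivSymbol (z : ℂ) : ℂ :=
  (γ : ℂ) * realPow (γ - 1) z * (Q a b A z)⁻¹
    - realPow γ z * (derivQ a b A z * ((Q a b A z)⁻¹ * (Q a b A z)⁻¹))

/-- The second derivative of `z ^ γ / Q z`. -/
noncomputable def derivSymbol₂ (z : ℂ) : ℂ :=
  ((γ * (γ - 1) : ℝ) : ℂ) * realPow (γ - 2) z * (Q a b A z)⁻¹
    - 2 * ((γ : ℂ) * realPow (γ - 1) z * (derivQ a b A z * ((Q a b A z)⁻¹ * (Q a b A z)⁻¹)))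
    - realPow γ z * (derivQ₂ a b A z * ((Q a b A z)⁻¹ * (Q a b A z)⁻¹))
    + 2 * (realPow γ z * (derivQ a b A z * derivQ a b A z
        * ((Q a b A z)⁻¹ * ((Q a b A z)⁻¹ * (Q a b A z)⁻¹))))

variable {a b A γ}

theorem hasDerivAt_inv_Q {z : ℂ} (hz : 0 ≤ z.re) (hz0 : z ≠ 0) (hQz : Q a b A z ≠ 0) :
    HasDerivAt (fun z => (Q a b A z)⁻¹)
      (-(derivQ a b A z * ((Q a b A z)⁻¹ * (Q a b A z)⁻¹))) z := by
  refine ((hasDerivAt_Q hz hz0).fun_inv hQz).congr_deriv ?_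
  field_simp

theorem hasDerivAt_symbol {z : ℂ} (hz : 0 ≤ z.re) (hz0 : z ≠ 0) (hQz : Q a b A z ≠ 0) :
    HasDerivAt (fun z => realPow γ z * (Q a b A z)⁻¹) (derivSymbol a b A γ z) z := by
  refine ((hasDerivAt_realPow γ hz hz0).mul (hasDerivAt_inv_Q hz hz0 hQz)).congr_deriv ?_
  rw [derivSymbol]
  ring

theorem hasDerivAt_derivSymbol {z : ℂ} (hz : 0 ≤ z.re) (hz0 : z ≠ 0) (hQz : Q a b A z ≠ 0) :
    HasDerivAt (derivSymbol a b A γ) (derivSymbol₂ a b A γ z) z := by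
  have hW := hasDerivAt_inv_Q hz hz0 hQz
  have h := (((hasDerivAt_realPow (γ - 1) hz hz0).const_mul (γ : ℂ)).mul hW).sub
    ((hasDerivAt_realPow γ hz hz0).mul ((hasDerivAt_derivQ (a := a) (b := b) (A := A) hz hz0).mul
      (hW.mul hW)))
  refine HasDerivAt.congr_deriv (f := derivSymbol a b A γ) h ?_
  rw [derivSymbol₂, show γ - 1 - 1 = γ - 2 by ring]
  simp only [Pi.mul_apply]
  push_cast
  ring

theorem derivSymbol_conj {z : ℂ} (hz : 0 ≤ z.re) :
    derivSymbol a b A γ ((starRingEnd ℂ) z) = (starRingEnd ℂ) (derivSymbol a b A γ z) := by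
  simp [derivSymbol, realPow_conj _ hz, Q_conj hz, derivQ_conj hz]

variable {m q : ℝ}

theorem powBound_derivQ (ha : 0 < a) (hb : 0 < b) (hma : m ≤ a) (hmb : m ≤ b) :
    PowBound (m - 1) (a + b - 1) (derivQ a b A) :=
  ((PowBound.const_mul_realPow (Or.inr (by linarith)) le_rfl).sub
    (PowBound.const_mul_realPow (Or.inr (by linarith)) (by linarith))).sub
    (PowBound.const_mul_realPow (Or.inr (by linarith)) (by linarith))

theorem powBound_derivQ₂ (ha : 0 < a) (hb : 0 < b) (hqab : q ≤ a + b) (hqa : a = 1 ∨ q ≤ a)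
    (hqb : b = 1 ∨ q ≤ b) : PowBound (q - 2) (a + b - 2) (derivQ₂ a b A) := by
  refine ((PowBound.const_mul_realPow (Or.inr (by linarith)) le_rfl).sub
    (PowBound.const_mul_realPow ?_ (by linarith))).sub
    (PowBound.const_mul_realPow ?_ (by linarith))
  · exact hqb.imp (fun h => by rw [h]; ring) (fun h => by linarith)
  · exact hqa.imp (fun h => by rw [h]; ring) (fun h => by linarith)

/-- Near the origin `1 / Q` is bounded, so the singularity comes only from `z^(γ-1)`, absent when `γ
= 0`, and from `Q'`, which is `O(|z|^(m-1))`. At infinity the derivative gains one power. -/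
theorem powBound_derivSymbol (ha : 0 < a) (hb : 0 < b) (hQ : ∀ s : ℂ, Q a b A s = 0 → s.re < 0)
    (hma : m ≤ a) (hmb : m ≤ b) (hγ : 0 ≤ γ) (hmγ : γ = 0 ∨ m ≤ γ) :
    PowBound (m - 1) (-1 - (a + b - γ)) (derivSymbol a b A γ) := by
  have hW := powBound_inv_Q ha hb hQ
  have h₁ : PowBound (m - 1) (γ - 1) fun z => (γ : ℂ) * realPow (γ - 1) z :=
    PowBound.const_mul_realPow (hmγ.imp id fun h => by linarith) le_rfl
  exact ((h₁.mul hW).mono (by linarith) (by linarith)).sub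
    (((PowBound.realPow γ).mul ((powBound_derivQ ha hb hma hmb).mul (hW.mul hW))).mono
      (by linarith) (by linarith))

/-- The condition `q ≤ 2 * m` covers products of two first-order factors, each `O(|z|^(m-1))`; the
other conditions on `q` cover genuine second derivatives, whose coefficients vanish for exponents
`0` and `1`. -/
theorem powBound_derivSymbol₂ (ha : 0 < a) (hb : 0 < b)
    (hQ : ∀ s : ℂ, Q a b A s = 0 → s.re < 0) (hma : m ≤ a) (hmb : m ≤ b) (hγ : 0 ≤ γ)
    (hmγ : γ = 0 ∨ m ≤ γ) (hqm : q ≤ 2 * m) (hqab : q ≤ a + b) (hqa : a = 1 ∨ q ≤ a)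
    (hqb : b = 1 ∨ q ≤ b) (hqγ : γ = 0 ∨ γ = 1 ∨ q ≤ γ) :
    PowBound (q - 2) (-2 - (a + b - γ)) (derivSymbol₂ a b A γ) := by
  have hW := powBound_inv_Q ha hb hQ
  have hQ₁ := powBound_derivQ (A := A) ha hb hma hmb
  have hQ₂ := powBound_derivQ₂ (A := A) ha hb hqab hqa hqb
  have h₁ : PowBound (m - 1) (γ - 1) fun z => (γ : ℂ) * realPow (γ - 1) z :=
    PowBound.const_mul_realPow (hmγ.imp id fun h => by linarith) le_rfl
  have h₂ : PowBound (q - 2) (γ - 2) fun z => ((γ * (γ - 1) : ℝ) : ℂ) * realPow (γ - 2) z := by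
    refine PowBound.const_mul_realPow ?_ le_rfl
    rcases hqγ with h | h | h
    · exact Or.inl (by rw [h]; ring)
    · exact Or.inl (by rw [h]; ring)
    · exact Or.inr (by linarith)
  exact ((((h₂.mul hW).mono (by linarith) (by linarith)).sub
    (((h₁.mul (hQ₁.mul (hW.mul hW))).mono (by linarith) (by linarith)).const_mul 2)).sub
    (((PowBound.realPow γ).mul (hQ₂.mul (hW.mul hW))).mono (by linarith) (by linarith))).add
    ((((PowBound.realPow γ).mul ((hQ₁.mul hQ₁).mul (hW.mul (hW.mul hW)))).mono
      (by linarith) (by linarith)).const_mul 2)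

/-- `S^β` exists, is integrable, and decays like `t ^ (-1 - min α₁ α₂)`. -/
theorem exists_isInverseLaplace_symbolS {β : ℝ} (ha : a ∈ Ioc (0 : ℝ) 1) (hb : b ∈ Ioc (0 : ℝ) 1)
    (hβ : β ∈ ({a, b, a + b} : Set ℝ)) (hQ : ∀ s : ℂ, Q a b A s = 0 → s.re < 0) :
    ∃ f : ℝ → ℝ, IsInverseLaplace (symbolS a b A β) f ∧ IntegrableOn f (Ioi 0) ∧
      ∃ K : ℝ, ∀ t : ℝ, 1 ≤ t → |f t| ≤ K * t ^ (-1 - min a b) := by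
  obtain ⟨ha0, ha1⟩ := ha
  obtain ⟨hb0, hb1⟩ := hb
  set m := min a b with hm
  have hma : m ≤ a := min_le_left _ _
  have hmb : m ≤ b := min_le_right _ _
  have hm0 : 0 < m := lt_min ha0 hb0
  have hm1 : m ≤ 1 := hma.trans ha1
  set γ := a + b - β with hγdef
  have hγ3 : γ = b ∨ γ = a ∨ γ = 0 := by
    simp only [mem_insert_iff, mem_singleton_iff] at hβ
    rcases hβ with h | h | h
    · exact Or.inl (by rw [hγdef, h]; ring)
    · exact Or.inr (Or.inl (by rw [hγdef, h]; ring))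
    · exact Or.inr (Or.inr (by rw [hγdef, h]; ring))
  have hβ0 : 0 < β := by rcases hγ3 with h | h | h <;> linarith
  have hβ2 : β ≤ 2 := by rcases hγ3 with h | h | h <;> linarith
  have hγ0 : 0 ≤ γ := by rcases hγ3 with h | h | h <;> linarith
  have hmγ : γ = 0 ∨ m ≤ γ := by
    rcases hγ3 with h | h | h
    · exact Or.inr (h ▸ hmb)
    · exact Or.inr (h ▸ hma)
    · exact Or.inl h
  have hβγ : a + b - γ = β := by rw [hγdef]; ring
  -- If `m < 1`, then `q = m` works. If `m = 1`, the excluded value `q = 1` has to be replaced by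
  -- `2`; then `a = b = 1` and `γ` is `0` or `1`, so the singular second-order terms disappear.
  obtain ⟨q, hq1, hmq, hqm, hqab, hqa, hqb, hqγ⟩ : ∃ q : ℝ, q ≠ 1 ∧ m ≤ q ∧ q ≤ 2 * m ∧
      q ≤ a + b ∧ (a = 1 ∨ q ≤ a) ∧ (b = 1 ∨ q ≤ b) ∧ (γ = 0 ∨ γ = 1 ∨ q ≤ γ) := by
    rcases hm1.lt_or_eq with h | h
    · exact ⟨m, h.ne, le_rfl, by linarith, by linarith, Or.inr hma, Or.inr hmb,
        hmγ.imp id Or.inr⟩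
    · have ea : a = 1 := le_antisymm ha1 (h ▸ hma)
      have eb : b = 1 := le_antisymm hb1 (h ▸ hmb)
      refine ⟨2, by norm_num, by linarith, by linarith, by linarith, Or.inl ea, Or.inl eb, ?_⟩
      rcases hγ3 with h | h | h
      · exact Or.inr (Or.inl (h.trans eb))
      · exact Or.inr (Or.inl (h.trans ea))
      · exact Or.inl h
  have hQne : ∀ z : ℂ, 0 ≤ z.re → Q a b A z ≠ 0 := fun z hz h => absurd (hQ z h) (not_lt.mpr hz)
  have hB₁ := powBound_derivSymbol ha0 hb0 hQ hma hmb hγ0 hmγ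
  have hB₂ := powBound_derivSymbol₂ ha0 hb0 hQ hma hmb hγ0 hmγ hqm hqab hqa hqb hqγ
  have hB₀ := (PowBound.realPow γ).mul (powBound_inv_Q ha0 hb0 hQ)
  rw [hβγ] at hB₁ hB₂
  obtain ⟨C₁, hC₁, h₁⟩ := hB₁.exists_norm_le (by linarith)
  obtain ⟨C₂, hC₂, h₂⟩ := hB₂.exists_norm_le (by linarith)
  obtain ⟨C₀, hC₀, h₀⟩ := hB₀
  have hsymb : symbolS a b A β = fun z => realPow γ z * (Q a b A z)⁻¹ := by
    funext z
    rw [symbolS, div_eq_mul_inv, realPow]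
  have hmax : ∀ {x C y : ℝ}, x ≤ C * y → C ≤ max C₁ C₂ → 0 ≤ y → x ≤ max C₁ C₂ * y :=
    fun h h' hy => h.trans (mul_le_mul_of_nonneg_right h' hy)
  have hne : ∀ z : ℂ, 0 < z.re → z ≠ 0 := fun z hz h => by simp [h] at hz
  rw [hsymb]
  refine exists_isInverseLaplace (G₁ := derivSymbol a b A γ) (G₂ := derivSymbol₂ a b A γ)
    (C := max C₁ C₂) (m := m) (β := β) (q := q)
    ⟨fun z hz hz0 => (hasDerivAt_derivSymbol hz hz0 (hQne z hz)).differentiableAt, hm0, hm1, hβ0,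
      fun z hz hz0 => hmax (h₁ z hz hz0).1 (le_max_left _ _) (by positivity),
      fun z hz hz0 => hmax (h₁ z hz hz0).2 (le_max_left _ _) (by positivity)⟩ hβ2
    (fun z hz => hasDerivAt_symbol hz.le (hne z hz) (hQne z hz.le)) ?_ hq1 hmq
    (fun z hz hz0 => hasDerivAt_derivSymbol hz hz0 (hQne z hz))
    (fun z hz hz0 => hmax (h₂ z hz hz0).1 (le_max_right _ _) (by positivity))
    (fun z hz hz0 => hmax (h₂ z hz hz0).2 (le_max_right _ _) (by positivity)) ?_
  · have hl : Tendsto (fun x : ℝ => C₀ * x ^ (-β)) atTop (𝓝 0) := by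
      simpa using (tendsto_rpow_neg_atTop hβ0).const_mul C₀
    refine squeeze_zero_norm' ?_ hl
    filter_upwards [eventually_ge_atTop 1] with x hx
    have hx0 : 0 < x := by linarith
    have hn : ‖(x : ℂ)‖ = x := Complex.norm_of_nonneg hx0.le
    have h := (h₀ x (by simpa using hx0.le) (by exact_mod_cast hx0.ne')).2 (by rwa [hn])
    rwa [hn, show γ + -(a + b) = -β by rw [← hβγ]; ring] at h
  · intro y
    rw [← derivSymbol_conj (by simp)]
    simp

end Symbol

end

/-! ### Convolution with an integrable kernel with a power tail -/

section

variable {f g : ℝ → ℝ}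

theorem intervalIntegrable_mul_comp_sub (hf : IntegrableOn f (Ioi 0)) (hg : ContinuousOn g (Ici 0))
    {t : ℝ} (ht : 0 ≤ t) : IntervalIntegrable (fun u => f u * g (t - u)) volume 0 t := by
  have h : IntervalIntegrable f volume 0 t :=
    (intervalIntegrable_iff_integrableOn_Ioc_of_le ht).mpr (hf.mono_set Ioc_subset_Ioi_self)
  refine h.mul_continuousOn (hg.comp (by fun_prop) fun u hu => ?_)
  rw [uIcc_of_le ht] at hu
  exact mem_Ici.mpr (by linarith [hu.2])

theorem conv_eq (f g : ℝ → ℝ) (t : ℝ) : conv f g t = ∫ u in (0 : ℝ)..t, f u * g (t - u) := by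
  have h := intervalIntegral.integral_comp_sub_left (a := 0) (b := t)
    (fun u => f u * g (t - u)) t
  simp only [sub_sub_cancel, sub_self, sub_zero] at h
  exact h

theorem intervalIntegrable_conv (hf : IntegrableOn f (Ioi 0)) (hg : ContinuousOn g (Ici 0))
    {t : ℝ} (ht : 0 ≤ t) : IntervalIntegrable (fun s => f (t - s) * g s) volume 0 t := by
  have h := (intervalIntegrable_mul_comp_sub hf hg ht).comp_sub_left t
  simp only [sub_sub_cancel, sub_self, sub_zero] at h
  exact h.symm

theorem abs_conv_le {t : ℝ} (ht : 0 ≤ t) :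
    |conv f g t| ≤ conv (fun t => |f t|) (fun t => |g t|) t := by
  rw [conv, conv]
  simp_rw [← abs_mul]
  exact intervalIntegral.abs_integral_le_integral_abs ht

theorem conv_abs_nonneg {t : ℝ} (ht : 0 ≤ t) : 0 ≤ conv (fun t => |f t|) (fun t => |g t|) t :=
  (abs_nonneg _).trans (abs_conv_le ht)

/-- Splitting a convolution at half the time. -/
theorem conv_abs_le (hf : IntegrableOn f (Ioi 0)) (hg : ContinuousOn g (Ici 0)) {M N t : ℝ}
    (ht : 0 ≤ t) (hM : ∀ s, 0 ≤ s → |g s| ≤ M) (hN : ∀ s, t / 2 ≤ s → |g s| ≤ N) :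
    conv (fun t => |f t|) (fun t => |g t|) t
      ≤ N * (∫ u in Ioi 0, |f u|) + M * ∫ u in Ioi (t / 2), |f u| := by
  have hfa : IntegrableOn (fun u => |f u|) (Ioi 0) := hf.abs
  have hM0 : 0 ≤ M := (abs_nonneg _).trans (hM 0 le_rfl)
  have hN0 : 0 ≤ N := (abs_nonneg _).trans (hN _ le_rfl)
  have ht2 : t / 2 ≤ t := by linarith
  have ht20 : 0 ≤ t / 2 := by linarith
  have hi := (intervalIntegrable_iff_integrableOn_Ioc_of_le ht).mp
    (intervalIntegrable_mul_comp_sub hfa hg.abs ht)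
  have hsub : Ioi (t / 2) ⊆ Ioi (0 : ℝ) := Ioi_subset_Ioi ht20
  -- For `u ≤ t / 2` the argument `t - u` is at least `t / 2`, so `N` bounds `g`; for `u > t / 2`
  -- only `M` is available, but the tail of `f` is small.
  rw [conv_eq, intervalIntegral.integral_of_le ht, ← Ioc_union_Ioc_eq_Ioc ht20 ht2,
    setIntegral_union (Ioc_disjoint_Ioc_of_le le_rfl) measurableSet_Ioc
      (hi.mono_set (Ioc_subset_Ioc le_rfl ht2)) (hi.mono_set (Ioc_subset_Ioc ht20 le_rfl)),
    ← integral_const_mul, ← integral_const_mul]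
  refine add_le_add ?_ ?_
  · refine (setIntegral_mono_on (hi.mono_set (Ioc_subset_Ioc le_rfl ht2))
      ((hfa.mono_set Ioc_subset_Ioi_self).const_mul N) measurableSet_Ioc fun u hu => ?_).trans
      (setIntegral_mono_set (hfa.const_mul N) (Eventually.of_forall fun u => by positivity)
        (Eventually.of_forall Ioc_subset_Ioi_self))
    rw [mul_comm]
    exact mul_le_mul_of_nonneg_right (hN _ (by linarith [hu.2])) (abs_nonneg _)
  · refine (setIntegral_mono_on (hi.mono_set (Ioc_subset_Ioc ht20 le_rfl))
      ((hfa.mono_set (Ioc_subset_Ioi_self.trans hsub)).const_mul M) measurableSet_Ioc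
      fun u hu => ?_).trans
      (setIntegral_mono_set ((hfa.mono_set hsub).const_mul M)
        (Eventually.of_forall fun u => by positivity) (Eventually.of_forall Ioc_subset_Ioi_self))
    rw [mul_comm]
    exact mul_le_mul_of_nonneg_right (hM _ (by linarith [hu.2])) (abs_nonneg _)

theorem integral_Ioi_abs_le (hf : IntegrableOn f (Ioi 0)) {K m : ℝ} (hm : 0 < m)
    (hK : ∀ t, 1 ≤ t → |f t| ≤ K * t ^ (-1 - m)) {t : ℝ} (ht : 1 ≤ t) :
    ∫ u in Ioi t, |f u| ≤ K / m * t ^ (-m) := by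
  have hfa : IntegrableOn (fun u => |f u|) (Ioi 0) := hf.abs
  have ht0 : 0 < t := by linarith
  refine (setIntegral_mono_on (hfa.mono_set (Ioi_subset_Ioi ht0.le))
    ((integrableOn_Ioi_rpow_of_lt (by linarith : -1 - m < -1) ht0).const_mul K)
    measurableSet_Ioi fun u hu => hK u (ht.trans (le_of_lt hu))).trans (le_of_eq ?_)
  rw [integral_const_mul, integral_Ioi_rpow_of_lt (by linarith) ht0,
    show -1 - m + 1 = -m by ring, neg_div_neg_eq]
  ring

theorem boundedOnHalfLine_of_eventually_le (hg : ContinuousOn g (Ici 0)) {M : ℝ}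
    (hM : ∀ᶠ t in atTop, |g t| ≤ M) : BoundedOnHalfLine g := by
  obtain ⟨T, hT⟩ := eventually_atTop.mp hM
  obtain ⟨D, hD⟩ := (isCompact_Icc (a := (0 : ℝ)) (b := T)).exists_bound_of_continuousOn
    (hg.mono fun t ht => ht.1)
  refine ⟨max M D, fun t ht => ?_⟩
  rcases le_total T t with h | h
  · exact (hT t h).trans (le_max_left _ _)
  · exact (hD t ⟨ht, h⟩).trans (le_max_right _ _)

theorem boundedOnHalfLine_conv_abs (hf : IntegrableOn f (Ioi 0)) (hg : ContinuousOn g (Ici 0))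
    (hb : BoundedOnHalfLine g) :
    BoundedOnHalfLine (conv (fun t => |f t|) (fun t => |g t|)) := by
  obtain ⟨M, hM⟩ := hb
  have hM0 : 0 ≤ M := (abs_nonneg _).trans (hM 0 le_rfl)
  refine ⟨M * (∫ u in Ioi 0, |f u|) + M * ∫ u in Ioi 0, |f u|, fun t ht => ?_⟩
  rw [abs_of_nonneg (conv_abs_nonneg ht)]
  refine (conv_abs_le hf hg ht hM (fun s hs => hM s (by linarith))).trans ?_
  refine add_le_add le_rfl (mul_le_mul_of_nonneg_left ?_ hM0)
  exact setIntegral_mono_set hf.abs (Eventually.of_forall fun u => abs_nonneg _)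
    (Eventually.of_forall (Ioi_subset_Ioi (by linarith)))

/-- In `conv_abs_le` both terms become small: `N` because `g` tends to zero, and the other because
the tail of `f` does. -/
theorem tendsto_conv_abs (hf : IntegrableOn f (Ioi 0)) {K m : ℝ} (hm : 0 < m)
    (hK : ∀ t, 1 ≤ t → |f t| ≤ K * t ^ (-1 - m)) (hg : ContinuousOn g (Ici 0))
    (hlim : Tendsto g atTop (𝓝 0)) :
    Tendsto (conv (fun t => |f t|) (fun t => |g t|)) atTop (𝓝 0) := by
  have hsmall : ∀ ε : ℝ, 0 < ε → ∀ᶠ t in atTop, |g t| ≤ ε := fun ε hε => by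
    have h := hlim.abs
    rw [abs_zero] at h
    exact h.eventually (Iic_mem_nhds hε)
  obtain ⟨M, hM⟩ := boundedOnHalfLine_of_eventually_le hg (hsmall 1 one_pos)
  set I := ∫ u in Ioi 0, |f u| with hI
  have hI0 : 0 ≤ I := integral_nonneg fun u => abs_nonneg _
  have hM0 : 0 ≤ M := (abs_nonneg _).trans (hM 0 le_rfl)
  have hhalf : Tendsto (fun t : ℝ => t / 2) atTop atTop := tendsto_id.atTop_div_const two_pos
  have htail : Tendsto (fun t : ℝ => M * (K / m * (t / 2) ^ (-m))) atTop (𝓝 0) := by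
    simpa using (((tendsto_rpow_neg_atTop hm).comp hhalf).const_mul (K / m)).const_mul M
  rw [Metric.tendsto_atTop']
  intro ε hε
  -- `I + 1` replaces `I`, which may be zero.
  have hε' : 0 < ε / (2 * (I + 1)) := by positivity
  obtain ⟨T, hT⟩ := eventually_atTop.mp (hsmall _ hε')
  obtain ⟨T', hT'⟩ := eventually_atTop.mp (htail.eventually (gt_mem_nhds (half_pos hε)))
  refine ⟨max 2 (max (2 * T) T'), fun t ht => ?_⟩
  have h2 : 2 ≤ t := (le_max_left _ _).trans ht.le
  have hT2 : 2 * T ≤ t := ((le_max_left _ _).trans (le_max_right _ _)).trans ht.le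
  have hT3 : T' ≤ t := ((le_max_right _ _).trans (le_max_right _ _)).trans ht.le
  have ht0 : 0 ≤ t := by linarith
  rw [Real.dist_0_eq_abs, abs_of_nonneg (conv_abs_nonneg ht0)]
  have h := conv_abs_le hf hg ht0 hM (fun s hs => hT s (by linarith))
  have h3 := mul_le_mul_of_nonneg_left
    (integral_Ioi_abs_le hf hm hK (by linarith : 1 ≤ t / 2)) hM0
  have h4 : ε / (2 * (I + 1)) * I ≤ ε / 2 := by
    rw [div_mul_eq_mul_div, div_le_div_iff₀ (by positivity) two_pos]
    nlinarith
  linarith [hT' t hT3]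

/-- The half-time split gives a term of order `(t/2)^(-η)` from the decay of `g` and one of order
`(t/2)^(-m)` from the tail of `f`; the slower rate wins. -/
theorem isBigO_conv_abs (hf : IntegrableOn f (Ioi 0)) {K m η : ℝ} (hm : 0 < m)
    (hK : ∀ t, 1 ≤ t → |f t| ≤ K * t ^ (-1 - m)) (hg : ContinuousOn g (Ici 0)) (hη : 0 ≤ η)
    (hO : g =O[atTop] fun t : ℝ => t ^ (-η)) :
    conv (fun t => |f t|) (fun t => |g t|) =O[atTop] fun t : ℝ => t ^ (-(min m η)) := by
  obtain ⟨D, hD0, hD⟩ := hO.exists_nonneg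
  obtain ⟨T₀, hT₀⟩ := eventually_atTop.mp hD.bound
  set T := max 1 T₀ with hTdef
  have hT : ∀ t, T ≤ t → |g t| ≤ D * t ^ (-η) := fun t ht => by
    have ht0 : 0 < t := zero_lt_one.trans_le ((le_max_left _ _).trans ht)
    have h := hT₀ t ((le_max_right _ _).trans ht)
    rwa [Real.norm_eq_abs, Real.norm_of_nonneg (by positivity)] at h
  obtain ⟨M, hM⟩ := boundedOnHalfLine_of_eventually_le (M := D) hg (by
    filter_upwards [eventually_ge_atTop T] with t ht
    exact (hT t ht).trans (mul_le_of_le_one_right hD0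
      (Real.rpow_le_one_of_one_le_of_nonpos ((le_max_left _ _).trans ht) (by linarith))))
  set I := ∫ u in Ioi 0, |f u| with hI
  have hI0 : 0 ≤ I := integral_nonneg fun u => abs_nonneg _
  have hM0 : 0 ≤ M := (abs_nonneg _).trans (hM 0 le_rfl)
  have hK0 : 0 ≤ K := by simpa using (abs_nonneg _).trans (hK 1 le_rfl)
  set μ := min m η with hμ
  -- The factor `(1 / 2) ^ (-μ)` turns `t ^ (-μ)` into `(t / 2) ^ (-μ)`.
  refine IsBigO.of_bound ((D * I + M * (K / m)) * (1 / 2) ^ (-μ)) ?_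
  filter_upwards [eventually_ge_atTop (2 * T)] with t ht
  have hT1 : 1 ≤ T := le_max_left _ _
  have ht0 : 0 < t := by linarith
  have ht1 : 1 ≤ t / 2 := by linarith
  have ht20 : 0 < t / 2 := by linarith
  rw [Real.norm_of_nonneg (conv_abs_nonneg ht0.le), Real.norm_of_nonneg (by positivity),
    mul_assoc, ← Real.mul_rpow (by norm_num) ht0.le, one_div_mul_eq_div]
  have h := conv_abs_le hf hg ht0.le hM (N := D * (t / 2) ^ (-μ)) fun s hs => by
    refine (hT s (by linarith)).trans (mul_le_mul_of_nonneg_left ?_ hD0)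
    refine (Real.rpow_le_rpow_of_nonpos ht20 hs (by linarith)).trans ?_
    exact Real.rpow_le_rpow_of_exponent_le ht1 (neg_le_neg (min_le_right _ _))
  have h2 := (integral_Ioi_abs_le hf hm hK ht1).trans (mul_le_mul_of_nonneg_left
    (Real.rpow_le_rpow_of_exponent_le ht1 (neg_le_neg (min_le_left m η)))
    (by positivity : 0 ≤ K / m))
  have h3 := mul_le_mul_of_nonneg_left h2 hM0
  calc conv (fun t => |f t|) (fun t => |g t|) t
      ≤ D * (t / 2) ^ (-μ) * I + M * (K / m * (t / 2) ^ (-μ)) := h.trans (by linarith)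
    _ = _ := by ring

end

end FracPlanar

/-! ### The main theorem -/

theorem theorem4p2 (α₁ α₂ : ℝ) (hα₁ : α₁ ∈ Ioc (0 : ℝ) 1) (hα₂ : α₂ ∈ Ioc (0 : ℝ) 1)
    (A : Matrix (Fin 2) (Fin 2) ℝ) (β : ℝ) (hβ : β ∈ ({α₁, α₂, α₁ + α₂} : Set ℝ))
    (hQ : ∀ s : ℂ, FracPlanar.Q α₁ α₂ A s = 0 → s.re < 0) :
    -- the inverse Laplace transform defining `S^β` exists
    FracPlanar.IsInverseLaplace (FracPlanar.symbolS α₁ α₂ A β) (FracPlanar.S α₁ α₂ A β) ∧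
    ∀ g : ℝ → ℝ, ContinuousOn g (Ici 0) →
      -- the convolution integrals converge absolutely
      (∀ t : ℝ, 0 ≤ t →
        IntervalIntegrable (fun s => FracPlanar.S α₁ α₂ A β (t - s) * g s) volume 0 t) ∧
      -- (i)
      (FracPlanar.BoundedOnHalfLine g →
        FracPlanar.BoundedOnHalfLine
          (FracPlanar.conv (fun t => |FracPlanar.S α₁ α₂ A β t|) (fun t => |g t|)) ∧
        FracPlanar.BoundedOnHalfLine (FracPlanar.conv (FracPlanar.S α₁ α₂ A β) g)) ∧
      -- (ii)
      (Tendsto g atTop (𝓝 0) →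
        Tendsto (FracPlanar.conv (fun t => |FracPlanar.S α₁ α₂ A β t|) (fun t => |g t|))
          atTop (𝓝 0) ∧
        Tendsto (FracPlanar.conv (FracPlanar.S α₁ α₂ A β) g) atTop (𝓝 0)) ∧
      -- (iii)
      (∀ η : ℝ, 0 ≤ η → g =O[atTop] (fun t : ℝ => t ^ (-η)) →
        FracPlanar.conv (fun t => |FracPlanar.S α₁ α₂ A β t|) (fun t => |g t|)
          =O[atTop] (fun t : ℝ => t ^ (-(min (min α₁ α₂) η))) ∧
        FracPlanar.conv (FracPlanar.S α₁ α₂ A β) g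
          =O[atTop] (fun t : ℝ => t ^ (-(min (min α₁ α₂) η)))) := by
  obtain ⟨f, hf, hint, K, hK⟩ :=
    FracPlanar.exists_isInverseLaplace_symbolS hα₁ hα₂ hβ hQ
  have hS : FracPlanar.S α₁ α₂ A β = f := FracPlanar.inverseLaplace_eq hf
  have hm : 0 < min α₁ α₂ := lt_min hα₁.1 hα₂.1
  rw [hS]
  refine ⟨hf, fun g hg => ⟨fun t ht => FracPlanar.intervalIntegrable_conv hint hg ht,
    fun hb => ?_, fun hlim => ?_, fun η hη hO => ?_⟩⟩
  · obtain ⟨M, hM⟩ := FracPlanar.boundedOnHalfLine_conv_abs hint hg hb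
    exact ⟨⟨M, hM⟩, M, fun t ht =>
      (FracPlanar.abs_conv_le ht).trans ((le_abs_self _).trans (hM t ht))⟩
  · have h := FracPlanar.tendsto_conv_abs hint hm hK hg hlim
    refine ⟨h, squeeze_zero_norm' ?_ h⟩
    filter_upwards [eventually_ge_atTop 0] with t ht using FracPlanar.abs_conv_le ht
  · have h := FracPlanar.isBigO_conv_abs hint hm hK hg hη hO
    refine ⟨h, IsBigO.trans (IsBigO.of_bound 1 ?_) h⟩
    filter_upwards [eventually_ge_atTop 0] with t ht
    rw [one_mul]
    exact (FracPlanar.abs_conv_le ht).trans (le_abs_self _)
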